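/- Let $V=\mathbb{R}^N$ with its standard inner product $g_0$, $\Lambda^k=\Lambda^kV^*$, and let $GL_N\mathbb{R}$ act on $\Lambda^k$ by $\rho(g)\alpha=(g^{-1})^*\alpha$. Let $\Phi^V=(\Phi^V_1,\dots,\Phi^V_l)\in\bigoplus_{i=1}^l\Lambda^{p_i}$ be such that its isotropy group $G=\{g\in GL_N\mathbb{R}:\rho(g)\Phi^V=\Phi^V\}$ is contained in $O(N)$, and let $\mathfrak{g}\subset \mathrm{End}(V)=V^*\otimes V$ be the Lie algebra of $G$. Let $E^2_{\Phi^V}\subset\bigoplus_i\Lambda^{p_i+1}$ be the image of the linear map $A^2:\Lambda^2\otimes V\to\bigoplus_i\Lambda^{p_i+1}$ with $A^2(\omega\otimes v)=\omega\wedge\iota_v\Phi^V$. Let $\mathfrak{g}^2\subset\Lambda^2\otimes V$ be the span of the elements $\sum_{i,j}(\alpha\wedge a^j_iv^i)\otimes v_j$ with $\alpha\in\Lambda^1$ and $\sum_{i,j}a^j_iv^i\otimes v_j\in\mathfrak{g}$, where $(v_i)$ is a basis of $V$ and $(v^i)$ its dual basis, and let $P^2_{\mathfrak{g}}$ be the orthogonal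 complement of $\mathfrak{g}^2$ in $\Lambda^2\otimes V$. Assume that $\dim E^2_{\Phi^V}=\dim P^2_{\mathfrak{g}}$. Let $M$ be a smooth manifold of dimension $N$ with frame bundle $F(M)$, whose fibre at $x$ is the set of linear isomorphisms $u:V\to T_xM$. Let $\Phi=(\Phi_1,\dots,\Phi_l)$ be a smooth section of the bundle $R_{\Phi^V}(M)=F(M)\times_{GL_N\mathbb{R}}(GL_N\mathbb{R}\cdot\Phi^V)\subset\bigoplus_i\Lambda^{p_i}T^*M$, where the orbit $GL_N\mathbb{R}\cdot\Phi^V\cong GL_N\mathbb{R}/G$ has the smooth structure of a homogeneous space; that is, near every point there is a smooth local frame $\tau$ with $\Phi_i=(\tau^{-1})^*\Phi^V_i$ for all $i$. Let $Q_\Phi$ be the $G$-structure on $M$ whose frames at $x$ are the $u\in F_x(M)$ with $(u^{-1})^*\Phi^V_i=(\Phi_i)_x$ for all $i$, let $g_\Phi$ be the Riemannian metric on $M$ with $g_\Phi(uv,uw)=g_0(v,w)$ for every such $u$ and all $v,w\in V$, and let $\nabla$ be the Levi-Civita connection of $g_\Phi$. Then the following conditions are equivalent: (i) $d\Phi_i=0$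 for all $i$; (ii) $Q_\Phi$ is a torsion-free $G$-structure, i.e. the Levi-Civita connection of $g_\Phi$ is reducible to a connection on the principal $G$-bundle of frames of $Q_\Phi$ (in every smooth local section of this bundle its connection form has values in $\mathfrak{g}$); (iii) $\nabla\Phi_i=0$ for all $i$. -/

import Mathlib

open scoped Manifold ContDiff

noncomputable section

namespace OrbitForm

/-! ### Linear algebra on `V = ℝ^N` -/

/-- `V = ℝ^N` with its standard inner product `g₀`. -/
abbrev V (N : ℕ) : Type := EuclideanSpace ℝ (Fin N)

/-- The orthogonal group `O(N)` as a subgroup of `GL(V)`. -/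
def orthogonal (N : ℕ) : Subgroup (V N ≃L[ℝ] V N) where
  carrier := {g | ∀ v w : V N, inner ℝ (g v) (g w) = inner ℝ v w}
  mul_mem' {a b} ha hb v w := (ha (b v) (b w)).trans (hb v w)
  one_mem' _ _ := rfl
  inv_mem' {a} ha v w := by
    have h := ha (a.symm v) (a.symm w)
    rw [a.apply_symm_apply, a.apply_symm_apply] at h
    exact h.symm

/-- Transport of a constant form on `V` along a linear isomorphism `u : V → W`, i.e. `(u⁻¹)^* α`.
For `W = V` this is the representation `ρ(u) α` of `GL(V)` on `Λ^k`. -/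
def push {N k : ℕ} {W : Type*} [AddCommGroup W] [Module ℝ W] [TopologicalSpace W]
    (u : V N ≃L[ℝ] W) (α : V N [⋀^Fin k]→L[ℝ] ℝ) : W [⋀^Fin k]→L[ℝ] ℝ :=
  α.compContinuousLinearMap (u.symm : W →L[ℝ] V N)

/-- The isotropy group `G = {g ∈ GL(V) : ρ(g) Φ^V = Φ^V}`. -/
def stabilizer {N l : ℕ} {p : Fin l → ℕ} (ΦV : ∀ i, V N [⋀^Fin (p i)]→L[ℝ] ℝ) :
    Subgroup (V N ≃L[ℝ] V N) where
  carrier := {g | ∀ i, push g (ΦV i) = ΦV i}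
  mul_mem' {a b} ha hb i := by
    calc push (a * b) (ΦV i) = push a (push b (ΦV i)) := rfl
      _ = ΦV i := by rw [hb i, ha i]
  one_mem' _ := rfl
  inv_mem' {a} ha i := by
    calc push a⁻¹ (ΦV i) = push a⁻¹ (push a (ΦV i)) := by rw [ha i]
      _ = ΦV i := by
        ext v
        simp only [push, ContinuousAlternatingMap.compContinuousLinearMap_apply]
        congr 1
        funext j
        exact a.symm_apply_apply (v j)

/-- The Lie algebra `𝔤 = Lie(G) ⊆ End(V)` of a closed subgroup `G` of `GL(V)`: the endomorphisms
whose one-parameter group stays in `G`. -/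
def lieAlg {N : ℕ} (G : Subgroup (V N ≃L[ℝ] V N)) : Set (V N →L[ℝ] V N) :=
  {X | ∀ t : ℝ, ∃ g ∈ G, (g : V N →L[ℝ] V N) = NormedSpace.exp (t • X)}

/-- The wedge product `α ∧ β ∈ Λ^{k+m} ⊗ W` of `α ∈ Λ^k` and `β ∈ Λ^m ⊗ W` (sum over shuffles);
`Λ^m ⊗ W` is the space of `W`-valued alternating `m`-linear maps on `V`. -/
def wedge {N k m : ℕ} {W : Type*} [AddCommGroup W] [Module ℝ W]
    (α : V N [⋀^Fin k]→ₗ[ℝ] ℝ) (β : V N [⋀^Fin m]→ₗ[ℝ] W) : V N [⋀^Fin (k + m)]→ₗ[ℝ] W :=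
  ((TensorProduct.lid ℝ W).toLinearMap.compAlternatingMap (α.domCoprod β)).domDomCongr
    finSumFinEquiv

/-- The interior product `ι_v φ`, equal to `0` on `0`-forms. -/
def interiorProd {N : ℕ} : {p : ℕ} → V N → (V N [⋀^Fin p]→ₗ[ℝ] ℝ) → V N [⋀^Fin (p - 1)]→ₗ[ℝ] ℝ
  | 0, _, _ => 0
  | _ + 1, v, φ => φ.curryLeft v

/-- The standard basis `e_j` of `V`. -/
abbrev e {N : ℕ} (j : Fin N) : V N := EuclideanSpace.single j 1

lemma wedge_add_left {N k m : ℕ} {W : Type*} [AddCommGroup W] [Module ℝ W]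
    (α α' : V N [⋀^Fin k]→ₗ[ℝ] ℝ) (β : V N [⋀^Fin m]→ₗ[ℝ] W) :
    wedge (α + α') β = wedge α β + wedge α' β := by
  unfold wedge
  rw [← AlternatingMap.domCoprod'_apply, TensorProduct.add_tmul, map_add]
  ext x
  simp

lemma wedge_smul_left {N k m : ℕ} {W : Type*} [AddCommGroup W] [Module ℝ W]
    (c : ℝ) (α : V N [⋀^Fin k]→ₗ[ℝ] ℝ) (β : V N [⋀^Fin m]→ₗ[ℝ] W) :
    wedge (c • α) β = c • wedge α β := by
  unfold wedge
  rw [← AlternatingMap.domCoprod'_apply, ← TensorProduct.smul_tmul', map_smul]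
  ext x
  simp

lemma interiorProd_sum {N p : ℕ} (c : Fin N → ℝ) (φ : V N [⋀^Fin p]→ₗ[ℝ] ℝ) :
    interiorProd (∑ j, c j • (e j : V N)) φ = ∑ j, c j • interiorProd (e j) φ := by
  cases p with
  | zero => simp [interiorProd]
  | succ p => simp [interiorProd]

lemma wedge_sum_right {N k m : ℕ} {W : Type*} [AddCommGroup W] [Module ℝ W]
    (α : V N [⋀^Fin k]→ₗ[ℝ] ℝ) (c : Fin N → ℝ) (β : Fin N → V N [⋀^Fin m]→ₗ[ℝ] W) :
    wedge α (∑ j, c j • β j) = ∑ j, c j • wedge α (β j) := by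
  let L : (V N [⋀^Fin m]→ₗ[ℝ] W) →ₗ[ℝ] (V N [⋀^Fin (k + m)]→ₗ[ℝ] W) :=
    { toFun := wedge α
      map_add' := fun β β' => by
        unfold wedge
        rw [← AlternatingMap.domCoprod'_apply, TensorProduct.tmul_add, map_add]
        ext x
        simp
      map_smul' := fun c β => by
        unfold wedge
        rw [← AlternatingMap.domCoprod'_apply, TensorProduct.tmul_smul, map_smul]
        ext x
        simp }
  change L _ = ∑ j, c j • L (β j)
  simp only [map_sum, map_smul]

/-- The `j`-th component of a `V`-valued form. -/
def component {N k : ℕ} (j : Fin N) : (V N [⋀^Fin k]→ₗ[ℝ] V N) →ₗ[ℝ] (V N [⋀^Fin k]→ₗ[ℝ] ℝ) where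
  toFun T := (EuclideanSpace.proj (𝕜 := ℝ) j).toLinearMap.compAlternatingMap T
  map_add' _ _ := by ext; simp
  map_smul' _ _ := by ext; simp

/-- The map `A^k : Λ^k ⊗ V → ⨁ᵢ Λ^{pᵢ+k-1}`, determined by `A^k(ω ⊗ v) = ω ∧ ι_v Φ^V`: an element
of `Λ^k ⊗ V` is written as `T = ∑ⱼ T^j ⊗ e_j`. The degree `pᵢ + k - 1` is spelled `k + (pᵢ - 1)`;
for `pᵢ = 0` the component is zero. -/
def A {N l : ℕ} {p : Fin l → ℕ} (ΦV : ∀ i, V N [⋀^Fin (p i)]→L[ℝ] ℝ) (k : ℕ) :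
    (V N [⋀^Fin k]→ₗ[ℝ] V N) →ₗ[ℝ] (∀ i, V N [⋀^Fin (k + (p i - 1))]→ₗ[ℝ] ℝ) where
  toFun T i := ∑ j, wedge (component j T) (interiorProd (e j) (ΦV i).toAlternatingMap)
  map_add' T T' := by
    funext i
    simp only [map_add, wedge_add_left, Finset.sum_add_distrib, Pi.add_apply]
  map_smul' c T := by
    funext i
    simp only [map_smul, wedge_smul_left, Finset.smul_sum, Pi.smul_apply, RingHom.id_apply]

lemma A_apply_tmul {N l : ℕ} {p : Fin l → ℕ} (ΦV : ∀ i, V N [⋀^Fin (p i)]→L[ℝ] ℝ) {k : ℕ}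
    (α : V N [⋀^Fin k]→ₗ[ℝ] ℝ) (v : V N) (i : Fin l) :
    A ΦV k ((LinearMap.toSpanSingleton ℝ (V N) v).compAlternatingMap α) i =
      wedge α (interiorProd v (ΦV i).toAlternatingMap) := by
  have h (j : Fin N) :
      component j ((LinearMap.toSpanSingleton ℝ (V N) v).compAlternatingMap α) = v j • α := by
    ext x
    simp [component, mul_comm]
  have hv : v = ∑ j, v j • (e j : V N) := by
    simpa using ((EuclideanSpace.basisFun (Fin N) ℝ).sum_repr v).symm
  change ∑ j : Fin N, wedge (component j _) _ = _
  simp only [h, wedge_smul_left]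
  conv_rhs => rw [hv, interiorProd_sum, wedge_sum_right]

/-- `E^k = Im(A^k)`. -/
def E {N l : ℕ} {p : Fin l → ℕ} (ΦV : ∀ i, V N [⋀^Fin (p i)]→L[ℝ] ℝ) (k : ℕ) :
    Submodule ℝ (∀ i, V N [⋀^Fin (k + (p i - 1))]→ₗ[ℝ] ℝ) :=
  LinearMap.range (A ΦV k)

/-- `𝔤^{k+1} ⊆ Λ^{k+1} ⊗ V`, the span of the `α ∧ a` with `α ∈ Λ^k` and `a ∈ 𝔤 ⊆ V^* ⊗ V`. -/
def gSucc {N : ℕ} (G : Subgroup (V N ≃L[ℝ] V N)) (k : ℕ) :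
    Submodule ℝ (V N [⋀^Fin (k + 1)]→ₗ[ℝ] V N) :=
  Submodule.span ℝ {T | ∃ α : V N [⋀^Fin k]→ₗ[ℝ] ℝ, ∃ a ∈ lieAlg G,
    T = wedge α (AlternatingMap.ofSubsingleton ℝ (V N) (V N) (0 : Fin 1) a.toLinearMap)}

/-- The inner product on `Λ^k ⊗ V` induced by `g₀`. -/
def formInner {N k : ℕ} (S T : V N [⋀^Fin k]→ₗ[ℝ] V N) : ℝ :=
  (∑ J : Fin k → Fin N, inner ℝ (S fun a => e (J a)) (T fun a => e (J a))) / (k.factorial : ℝ)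

/-- `P^{k+1}`, the orthogonal complement of `𝔤^{k+1}` in `Λ^{k+1} ⊗ V`. -/
def PSucc {N : ℕ} (G : Subgroup (V N ≃L[ℝ] V N)) (k : ℕ) :
    Submodule ℝ (V N [⋀^Fin (k + 1)]→ₗ[ℝ] V N) where
  carrier := {T | ∀ S ∈ gSucc G k, formInner S T = 0}
  add_mem' {T T'} hT hT' S hS := by
    have h := hT S hS
    have h' := hT' S hS
    unfold formInner at h h' ⊢
    simp only [AlternatingMap.add_apply, inner_add_right, Finset.sum_add_distrib, add_div]
    rw [h, h', add_zero]
  zero_mem' S _ := by simp [formInner]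
  smul_mem' c T hT S hS := by
    have h := hT S hS
    unfold formInner at h ⊢
    simp only [AlternatingMap.smul_apply, inner_smul_right, ← Finset.mul_sum, mul_div_assoc]
    rw [h, mul_zero]

/-! ### Geometry on an `N`-dimensional manifold -/

section Manifold

variable {N : ℕ} {M : Type*} [TopologicalSpace M] [ChartedSpace (V N) M]

/-- The fibre `F_x(M)` of the frame bundle: linear isomorphisms `V → T_x M`. -/
abbrev Frame (N : ℕ) {M : Type*} [TopologicalSpace M] [ChartedSpace (V N) M] (x : M) : Type :=
  V N ≃L[ℝ] TangentSpace (𝓡 N) x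

/-- `Y` is a vector field that is differentiable at `x`. -/
def FieldDiffAt [IsManifold (𝓡 N) ∞ M] (Y : ∀ y : M, TangentSpace (𝓡 N) y) (x : M) : Prop :=
  MDifferentiableAt (𝓡 N) (𝓡 N).tangent (fun y => (⟨y, Y y⟩ : TangentBundle (𝓡 N) M)) x

/-- `τ` is a smooth local section of the frame bundle over `U` (its values off `U` are
irrelevant). -/
def SmoothFrameOn [IsManifold (𝓡 N) ∞ M] (τ : ∀ y : M, Frame N y) (U : Set M) : Prop :=
  ∀ w : V N, ContMDiffOn (𝓡 N) (𝓡 N).tangent ∞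
    (fun y => (⟨y, τ y w⟩ : TangentBundle (𝓡 N) M)) U

/-- A smooth section `Φ` of `R_{Φ^V}(M) = F(M) ×_{GL} R_{Φ^V}(V)`, where the orbit
`R_{Φ^V}(V) ≅ GL/G` carries the smooth structure of the homogeneous space. As
`R_{Φ^V}(M) ≅ F(M)/G` and `F(M) → F(M)/G` is a surjective submersion, smoothness means that `Φ` is
locally of the form `τ ×_{GL} Φ^V` with a smooth local frame `τ`. -/
structure OrbitSection [IsManifold (𝓡 N) ∞ M] {l : ℕ} {p : Fin l → ℕ}
    (ΦV : ∀ i, V N [⋀^Fin (p i)]→L[ℝ] ℝ) where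
  form : ∀ (i : Fin l) (x : M), TangentSpace (𝓡 N) x [⋀^Fin (p i)]→L[ℝ] ℝ
  smooth : ∀ x : M, ∃ U : Set M, IsOpen U ∧ x ∈ U ∧ ∃ τ : ∀ y : M, Frame N y,
    SmoothFrameOn τ U ∧ ∀ y ∈ U, ∀ i, form i y = push (τ y) (ΦV i)

/-- A `G`-structure, i.e. a smooth section `Q` of `R_G(M) = F(M)/G`. The point `Q_x ∈ F_x(M)/G` is
recorded as the orbit `Q̃_x = u G` in `F_x(M)`, and smoothness as the existence of smooth local
sections of the principal `G`-bundle `Q̃`. -/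
structure GStructure (M : Type*) [TopologicalSpace M] [ChartedSpace (V N) M]
    [IsManifold (𝓡 N) ∞ M] (G : Subgroup (V N ≃L[ℝ] V N)) where
  frames : ∀ x : M, Set (Frame N x)
  isOrbit : ∀ x, ∃ u : Frame N x, frames x = {u' | ∃ g ∈ G, u' = g.trans u}
  smooth : ∀ x : M, ∃ U : Set M, IsOpen U ∧ x ∈ U ∧ ∃ τ : ∀ y : M, Frame N y,
    SmoothFrameOn τ U ∧ ∀ y ∈ U, τ y ∈ frames y

/-- The Riemannian metric `g_Q`, `g_Q(u v, u w) = g₀(v, w)` for `u ∈ Q̃_x`; it does not depend on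
the choice of `u` when `G ≤ O(N)`, see `GStructure.metric_eq`. -/
def GStructure.metric [IsManifold (𝓡 N) ∞ M] {G : Subgroup (V N ≃L[ℝ] V N)}
    (Q : GStructure M G) (x : M) (v w : TangentSpace (𝓡 N) x) : ℝ :=
  inner ℝ ((Q.isOrbit x).choose.symm v) ((Q.isOrbit x).choose.symm w)

lemma GStructure.metric_eq [IsManifold (𝓡 N) ∞ M] {G : Subgroup (V N ≃L[ℝ] V N)}
    (hG : G ≤ orthogonal N) (Q : GStructure M G) (x : M) (u : Frame N x) (hu : u ∈ Q.frames x)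
    (v w : V N) : Q.metric x (u v) (u w) = inner ℝ v w := by
  have h := (Q.isOrbit x).choose_spec
  rw [h] at hu
  obtain ⟨g, hg, hug⟩ := hu
  have key : ∀ z : V N, (Q.isOrbit x).choose.symm (u z) = g z := by
    intro z
    rw [ContinuousLinearEquiv.symm_apply_eq, hug]
    rfl
  unfold GStructure.metric
  rw [key, key]
  exact hG hg v w

/-- The `G`-structure `Q_Φ` of a section `Φ` of `R_{Φ^V}(M)`: its frames are those that carry
`Φ^V` to `Φ_x`. -/
def OrbitSection.toGStructure [IsManifold (𝓡 N) ∞ M] {l : ℕ} {p : Fin l → ℕ}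
    {ΦV : ∀ i, V N [⋀^Fin (p i)]→L[ℝ] ℝ} (Φ : OrbitSection (M := M) ΦV) :
    GStructure M (stabilizer ΦV) where
  frames x := {u | ∀ i, Φ.form i x = push u (ΦV i)}
  isOrbit x := by
    obtain ⟨U, -, hx, τ, -, hτ⟩ := Φ.smooth x
    refine ⟨τ x, Set.ext fun u => ⟨fun hu => ⟨u.trans (τ x).symm, fun i => ?_, ?_⟩, ?_⟩⟩
    · have h : push u (ΦV i) = push (τ x) (ΦV i) := (hu i).symm.trans (hτ x hx i)
      ext v
      have h2 := congrArg (fun α => α fun j => τ x (v j)) h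
      simpa [push, Function.comp_def] using h2
    · ext v
      simp
    · rintro ⟨g, hg, rfl⟩ i
      rw [hτ x hx i]
      calc push (τ x) (ΦV i) = push (τ x) (push g (ΦV i)) := by rw [hg i]
        _ = push (g.trans (τ x)) (ΦV i) := rfl
  smooth x := by
    obtain ⟨U, hU, hx, τ, hs, hτ⟩ := Φ.smooth x
    exact ⟨U, hU, hx, τ, hs, fun y hy i => hτ y hy i⟩

/-- The exterior derivative of a `k`-form `η` on `M`: at `x` it is computed in the chart at `x`. -/
def extDerivM {k : ℕ} (η : ∀ x : M, TangentSpace (𝓡 N) x [⋀^Fin k]→L[ℝ] ℝ) (x : M) :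
    TangentSpace (𝓡 N) x [⋀^Fin (k + 1)]→L[ℝ] ℝ :=
  (extDeriv (fun z : V N => (η ((extChartAt (𝓡 N) x).symm z)).compContinuousLinearMap
      (mfderiv 𝓘(ℝ, V N) (𝓡 N) (extChartAt (𝓡 N) x).symm z))
    (extChartAt (𝓡 N) x x)).compContinuousLinearMap
      (mfderiv (𝓡 N) 𝓘(ℝ, V N) (extChartAt (𝓡 N) x) x)

/-- A covariant derivative on `TM`; `∇ Y x v` is `∇_v Y` at `x`. -/
abbrev Connection (N : ℕ) (M : Type*) [TopologicalSpace M] [ChartedSpace (V N) M]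
    [IsManifold (𝓡 N) ∞ M] :=
  CovariantDerivative (𝓡 N) (V N) (TangentSpace (𝓡 N) : M → Type _)

/-- `∇` is the Levi-Civita connection of the Riemannian metric `g`: it is torsion-free and
metric. -/
def IsLeviCivita [IsManifold (𝓡 N) ∞ M]
    (g : ∀ x : M, TangentSpace (𝓡 N) x → TangentSpace (𝓡 N) x → ℝ) (nabla : Connection N M) :
    Prop :=
  nabla.torsion = 0 ∧
  ∀ (x : M) (Y Z : ∀ y : M, TangentSpace (𝓡 N) y), FieldDiffAt Y x → FieldDiffAt Z x →
    ∀ v : TangentSpace (𝓡 N) x,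
      mvfderiv (𝓡 N) (fun y => g y (Y y) (Z y)) x v =
        g x (nabla Y x v) (Z x) + g x (Y x) (nabla Z x v)

/-- `∇` is a connection on `Q`, i.e. reduces to a connection on the principal `G`-bundle `Q̃`: in
every smooth local section `τ` of `Q̃` its connection form has values in `𝔤`. -/
def GStructure.IsConnection [IsManifold (𝓡 N) ∞ M] {G : Subgroup (V N ≃L[ℝ] V N)}
    (Q : GStructure M G) (nabla : Connection N M) : Prop :=
  ∀ (U : Set M) (τ : ∀ y : M, Frame N y), IsOpen U → SmoothFrameOn τ U →
    (∀ y ∈ U, τ y ∈ Q.frames y) →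
    ∀ x ∈ U, ∀ v : TangentSpace (𝓡 N) x, ∃ X ∈ lieAlg G, ∀ w : V N,
      nabla (fun y => τ y w) x v = τ x (X w)

/-- `Q` is a torsion-free `G`-structure: the Levi-Civita connection of `g_Q` is a connection
on `Q`. -/
def GStructure.IsTorsionFree [IsManifold (𝓡 N) ∞ M] {G : Subgroup (V N ≃L[ℝ] V N)}
    (Q : GStructure M G) : Prop :=
  ∃ nabla : Connection N M, IsLeviCivita Q.metric nabla ∧ Q.IsConnection nabla

/-- `(∇_v η)(Y₁, …, Y_k) = v(η(Y₁, …, Y_k)) - ∑ⱼ η(Y₁, …, ∇_v Yⱼ, …, Y_k)` at `x`. -/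
def covDerivForm [IsManifold (𝓡 N) ∞ M] (nabla : Connection N M) {k : ℕ}
    (η : ∀ x : M, TangentSpace (𝓡 N) x [⋀^Fin k]→L[ℝ] ℝ) (x : M) (v : TangentSpace (𝓡 N) x)
    (Y : Fin k → ∀ y : M, TangentSpace (𝓡 N) y) : ℝ :=
  mvfderiv (𝓡 N) (fun y => η y fun j => Y j y) x v -
    ∑ j, η x (Function.update (fun j => Y j x) j (nabla (Y j) x v))

/-- `∇η = 0`. -/
def IsParallel [IsManifold (𝓡 N) ∞ M] (nabla : Connection N M) {k : ℕ}
    (η : ∀ x : M, TangentSpace (𝓡 N) x [⋀^Fin k]→L[ℝ] ℝ) : Prop :=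
  ∀ (x : M) (v : TangentSpace (𝓡 N) x) (Y : Fin k → ∀ y : M, TangentSpace (𝓡 N) y),
    (∀ j, FieldDiffAt (Y j) x) → covDerivForm nabla η x v Y = 0

end Manifold

end OrbitForm

end

open scoped Manifold ContDiff

noncomputable section

namespace OrbitForm

/-! ### Alternatization of multilinear maps -/

section Alternatization

open Equiv

variable {E F : Type*} [AddCommGroup E] [Module ℝ E] [AddCommGroup F] [Module ℝ F]

/-! In a local frame `τ` of the `G`-structure, `Φ` has the constant coefficients `Φ^V`, so all its
derivatives are read off from the connection form `θ ∈ V^* ⊗ End(V)` of `∇` at a point: `∇Φ` is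
minus the infinitesimal action `θ · Φ^V` (`covDerivForm_eq_neg_infAct`). When `∇` is torsion-free,
`dΦ` is minus the alternation of this action (`extDerivM_eq_neg_alternatize`). As `𝔤` is the
annihilator of `Φ^V` in `End(V)` (`mem_lieAlg_stabilizer_iff`), reducibility of `∇` gives `∇Φ = 0`,
which in turn gives `dΦ = 0`.

The substance is the passage from `dΦ = 0` to `𝔤`-valued `θ`. Up to a nonzero factor, the alternated
action of `θ` is `A²` of the skew part of `θ` (`sum_wedge_skewPart_eq_zero_iff`), so that skew part
lies in `ker A²`. Always `𝔤² ⊆ ker A²`, and the dimension hypothesis turns this into an equality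
(`gSucc_eq_ker_A`). Hence some `𝔤`-valued `η` has the same skew part as `θ`. Since `∇` is metric and
`G ≤ O(N)`, both are `𝔰𝔬(N)`-valued; their difference is symmetric with skew values, thus zero
(`eq_zero_of_symm_of_skew`).

Existence of the Levi-Civita connection is proved by the Koszul formula in an orthonormal frame
(`GStructure.exists_isLeviCivita`). -/

lemma alternatization_domDomCongr_perm {ι : Type*} [Fintype ι] [DecidableEq ι]
    (m : MultilinearMap ℝ (fun _ : ι => E) F) (σ : Perm ι) :
    MultilinearMap.alternatization (m.domDomCongr σ) =
      Perm.sign σ • MultilinearMap.alternatization m := by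
  ext v
  simp only [AlternatingMap.smul_apply, MultilinearMap.alternatization_apply,
    MultilinearMap.domDomCongr_apply, Finset.smul_sum]
  refine Fintype.sum_equiv (Equiv.mulRight σ) _ _ fun τ => ?_
  simp only [Equiv.coe_mulRight, Perm.coe_mul, Function.comp_apply, Perm.sign_mul, smul_smul]
  congr 1
  rw [mul_comm (Perm.sign τ), ← mul_assoc, Int.units_mul_self, one_mul]

lemma alternatization_domDomCongr {ι κ : Type*} [Fintype ι] [DecidableEq ι] [Fintype κ]
    [DecidableEq κ] (m : MultilinearMap ℝ (fun _ : ι => E) F) (e : ι ≃ κ) :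
    MultilinearMap.alternatization (m.domDomCongr e) =
      (MultilinearMap.alternatization m).domDomCongr e := by
  ext v
  simp only [AlternatingMap.domDomCongr_apply, MultilinearMap.alternatization_apply,
    MultilinearMap.domDomCongr_apply]
  refine Fintype.sum_equiv e.symm.permCongr _ _ fun τ => ?_
  simp [Equiv.permCongr_apply]

/-- The left-hand map is the sum of signed copies of `m` permuted by the `n + 1` cycles that bring
an index to the front. It is already alternating, so alternatizing multiplies it by `(n + 1)!`,
while each signed copy contributes one full alternatization of `m`. -/
lemma factorial_smul_alternatizeUncurryFin {n : ℕ} (f : E →ₗ[ℝ] E [⋀^Fin n]→ₗ[ℝ] F)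
    (m : MultilinearMap ℝ (fun _ : Fin (n + 1) => E) F)
    (hm : ∀ v, m v = f (v 0) (fun j => v j.succ)) :
    (n + 1).factorial • AlternatingMap.alternatizeUncurryFin f =
      (n + 1) • MultilinearMap.alternatization m := by
  have h : (AlternatingMap.alternatizeUncurryFin f : MultilinearMap ℝ (fun _ => E) F) =
      ∑ q : Fin (n + 1), Perm.sign q.cycleRange.symm • m.domDomCongr q.cycleRange.symm := by
    ext v
    simp [AlternatingMap.alternatizeUncurryFin_apply, hm, Units.smul_def,
      Perm.sign_symm, Fin.sign_cycleRange]
    refine Finset.sum_congr rfl fun q _ => ?_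
    have h0 : q.cycleRange.symm 0 = q := Fin.cycleRange_symm_zero q
    have h1 (j : Fin n) : q.cycleRange.symm j.succ = q.succAbove j := Fin.cycleRange_symm_succ q j
    rw [h0]
    exact congrArg (fun w => (-1 : ℤ) ^ (q : ℕ) • f (v q) w)
      (funext fun j => congrArg v (h1 j).symm)
  have h2 := AlternatingMap.coe_alternatization (AlternatingMap.alternatizeUncurryFin f)
  rw [h, Fintype.card_fin, map_sum] at h2
  rw [← h2, Finset.sum_congr rfl fun q _ => ?_, Finset.sum_const, Finset.card_univ,
    Fintype.card_fin]
  have : MultilinearMap.alternatization (Perm.sign q.cycleRange.symm •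
      m.domDomCongr q.cycleRange.symm) = Perm.sign q.cycleRange.symm •
      MultilinearMap.alternatization (m.domDomCongr q.cycleRange.symm) := by
    rw [Units.smul_def, Units.smul_def, map_zsmul]
  rw [this, alternatization_domDomCongr_perm, smul_smul, Int.units_mul_self, one_smul]

end Alternatization

/-! ### Wedge products and the infinitesimal action of End(V) -/

lemma exists_multilinear_smul {N k m : ℕ} {W : Type*} [AddCommGroup W] [Module ℝ W]
    (α : V N [⋀^Fin k]→ₗ[ℝ] ℝ) (β : V N [⋀^Fin m]→ₗ[ℝ] W) :
    ∃ w : MultilinearMap ℝ (fun _ : Fin (k + m) => V N) W, ∀ v,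
      w v = α (fun j => v (Fin.castAdd m j)) • β (fun j => v (Fin.natAdd k j)) :=
  ⟨((TensorProduct.lid ℝ W).toLinearMap.compMultilinearMap
    (MultilinearMap.domCoprod (α : MultilinearMap ℝ (fun _ => V N) ℝ)
      (β : MultilinearMap ℝ (fun _ => V N) W))).domDomCongr finSumFinEquiv,
    fun v => by simp [MultilinearMap.domCoprod_apply]⟩

/-- Trades the shuffle sum for a sum over all permutations: each shuffle class has `k! m!` elements.
Wedge products and alternated actions then become comparable as alternatizations. -/
lemma factorial_smul_wedge {N k m : ℕ} {W : Type*} [AddCommGroup W] [Module ℝ W]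
    (α : V N [⋀^Fin k]→ₗ[ℝ] ℝ) (β : V N [⋀^Fin m]→ₗ[ℝ] W)
    (w : MultilinearMap ℝ (fun _ : Fin (k + m) => V N) W)
    (hw : ∀ v, w v = α (fun j => v (Fin.castAdd m j)) • β (fun j => v (Fin.natAdd k j))) :
    (k.factorial * m.factorial) • wedge α β = MultilinearMap.alternatization w := by
  have h := MultilinearMap.domCoprod_alternization_eq α β
  rw [Fintype.card_fin, Fintype.card_fin] at h
  have h1 : w = ((TensorProduct.lid ℝ W).toLinearMap.compMultilinearMap
      (MultilinearMap.domCoprod (α : MultilinearMap ℝ (fun _ => V N) ℝ)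
        (β : MultilinearMap ℝ (fun _ => V N) W))).domDomCongr finSumFinEquiv := by
    ext v
    simp [hw, MultilinearMap.domCoprod_apply]
  rw [h1, alternatization_domDomCongr, LinearMap.compMultilinearMap_alternatization, h]
  ext v
  simp [wedge]

/-- The infinitesimal action of `X ∈ End(V)` on a form, `(X, φ) ↦ ∑ⱼ φ(…, X vⱼ, …)`. -/
def infAct {N k : ℕ} (φ : V N [⋀^Fin k]→L[ℝ] ℝ) :
    (V N →L[ℝ] V N) →L[ℝ] (V N [⋀^Fin k]→L[ℝ] ℝ) :=
  φ.fderivCompContinuousLinearMap (ContinuousLinearMap.id ℝ (V N))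

lemma infAct_apply {N k : ℕ} (φ : V N [⋀^Fin k]→L[ℝ] ℝ) (X : V N →L[ℝ] V N) (v : Fin k → V N) :
    infAct φ X v = ∑ j, φ (Function.update v j (X (v j))) := by
  rw [infAct, ContinuousAlternatingMap.fderivCompContinuousLinearMap_apply]
  refine Finset.sum_congr rfl fun j _ => congrArg φ (funext fun a => ?_)
  by_cases h : a = j
  · subst h; simp
  · simp [h]

/-- The form-valued linear map `v ↦ θ(v) · φ` for `θ ∈ V^* ⊗ End(V)`. -/
def infActMap {N k : ℕ} (θ : V N →L[ℝ] V N →L[ℝ] V N) (φ : V N [⋀^Fin k]→L[ℝ] ℝ) :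
    V N →ₗ[ℝ] V N [⋀^Fin k]→ₗ[ℝ] ℝ where
  toFun v := (infAct φ (θ v)).toAlternatingMap
  map_add' v w := by ext; simp
  map_smul' c v := by ext; simp

/-- The antisymmetrization `V^* ⊗ V^* ⊗ V → Λ² ⊗ V`. -/
def skewPart {N : ℕ} (θ : V N →L[ℝ] V N →L[ℝ] V N) : V N [⋀^Fin 2]→ₗ[ℝ] V N :=
  AlternatingMap.alternatizeUncurryFin
    { toFun := fun v => AlternatingMap.ofSubsingleton ℝ (V N) (V N) (0 : Fin 1) (θ v).toLinearMap
      map_add' := fun v w => by ext; simp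
      map_smul' := fun c v => by ext; simp }

lemma skewPart_apply {N : ℕ} (θ : V N →L[ℝ] V N →L[ℝ] V N) (v : Fin 2 → V N) :
    skewPart θ v = θ (v 0) (v 1) - θ (v 1) (v 0) := by
  simp [skewPart, AlternatingMap.alternatizeUncurryFin_apply, Fin.sum_univ_two, Fin.removeNth,
    sub_eq_add_neg]

/-- The multilinear map `(v₀, …, v_{q+1}) ↦ φ(θ(v₀) v₁, v₂, …, v_{q+1})`. -/
def headContraction {N q : ℕ} (θ : V N →L[ℝ] V N →L[ℝ] V N) (φ : V N [⋀^Fin (q + 1)]→L[ℝ] ℝ) :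
    MultilinearMap ℝ (fun _ : Fin (q + 2) => V N) ℝ :=
  LinearMap.uncurryLeft (M := fun _ : Fin (q + 2) => V N)
    { toFun := fun v => LinearMap.uncurryLeft (M := fun _ : Fin (q + 1) => V N)
        { toFun := fun w => (φ.toAlternatingMap.curryLeft (θ v w)).toMultilinearMap
          map_add' := fun w w' => by rw [map_add, map_add]; rfl
          map_smul' := fun c w => by rw [map_smul, map_smul]; rfl }
      map_add' := fun v w => by ext; simp; rfl
      map_smul' := fun c v => by ext; simp; exact Or.inl rfl }

lemma headContraction_apply {N q : ℕ} (θ : V N →L[ℝ] V N →L[ℝ] V N)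
    (φ : V N [⋀^Fin (q + 1)]→L[ℝ] ℝ) (v : Fin (q + 2) → V N) :
    headContraction θ φ v = φ (Matrix.vecCons (θ (v 0) (v 1)) fun j => v j.succ.succ) := by
  rfl

/-- Each of the `q + 1` terms of the action has `θ(v₀)vⱼ` in slot `j`. Moving it to the front turns
the term into a signed permutation of `headContraction`, and all of these have the same
alternatization. -/
lemma factorial_smul_alternatize_infActMap {N q : ℕ} (θ : V N →L[ℝ] V N →L[ℝ] V N)
    (φ : V N [⋀^Fin (q + 1)]→L[ℝ] ℝ) :
    (q + 2).factorial • AlternatingMap.alternatizeUncurryFin (infActMap θ φ) =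
      ((q + 2) * (q + 1)) • MultilinearMap.alternatization (headContraction θ φ) := by
  -- `σ j` fixes `0`, the direction slot, and cycles the others so that slot `1` receives `j.succ`.
  let σ (j : Fin (q + 1)) : Equiv.Perm (Fin (q + 2)) :=
    Equiv.Perm.decomposeFin.symm (0, j.cycleRange.symm)
  have hσ (j : Fin (q + 1)) : Equiv.Perm.sign (σ j) = (-1) ^ (j : ℕ) := by
    simp [σ, Equiv.Perm.decomposeFin.symm_sign, Equiv.Perm.sign_symm, Fin.sign_cycleRange]
  rw [factorial_smul_alternatizeUncurryFin (infActMap θ φ)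
    (∑ j, Equiv.Perm.sign (σ j) • (headContraction θ φ).domDomCongr (σ j)) ?_, map_sum,
    Finset.sum_congr rfl fun j _ => ?_, Finset.sum_const, Finset.card_univ, Fintype.card_fin,
    smul_smul]
  · rw [Units.smul_def, map_zsmul, ← Units.smul_def, alternatization_domDomCongr_perm, smul_smul,
      Int.units_mul_self, one_smul]
  · intro v
    have h : infActMap θ φ (v 0) (fun j => v j.succ) =
        infAct φ (θ (v 0)) (fun j => v j.succ) := rfl
    rw [h, infAct_apply, sum_apply]
    refine Finset.sum_congr rfl fun j _ => ?_
    rw [smul_apply, hσ, MultilinearMap.domDomCongr_apply, headContraction_apply]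
    have h2 : Function.update (fun j : Fin (q + 1) => v j.succ) j (θ (v 0) (v j.succ)) =
        j.insertNth (θ (v 0) (v j.succ)) (j.removeNth fun j : Fin (q + 1) => v j.succ) := by
      rw [Fin.insertNth_removeNth]
    rw [h2]
    have h3 := AlternatingMap.map_insertNth φ.toAlternatingMap j (θ (v 0) (v j.succ))
      (j.removeNth fun j : Fin (q + 1) => v j.succ)
    refine Eq.trans ?_ h3.symm
    · have e1 : σ j 0 = 0 := by simp [σ]
      have e2 (a : Fin (q + 1)) : σ j a.succ = (j.cycleRange.symm a).succ := by
        simp [σ]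
      have e3 : σ j 1 = j.succ := by
        rw [← Fin.succ_zero_eq_one, e2, Fin.cycleRange_symm_zero]
      simp only [e1, e2, e3, Fin.cycleRange_symm_succ, Units.smul_def]
      push_cast
      rfl

/-- Contraction is linear in the vector, so the sum over `j` contracts `φ` with the vector value of
`skewPart θ`. Its two terms differ by exchanging the first two arguments, hence the factor `2` after
alternatization. -/
lemma sum_wedge_skewPart_eq {N q : ℕ} (θ : V N →L[ℝ] V N →L[ℝ] V N)
    (φ : V N [⋀^Fin (q + 1)]→L[ℝ] ℝ) :
    (Nat.factorial 2 * q.factorial) •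
      (∑ j, wedge (component j (skewPart θ)) (φ.toAlternatingMap.curryLeft (e j))) =
      2 • (MultilinearMap.alternatization (headContraction θ φ)).domDomCongr
        (finCongr (Nat.add_comm q 2)) := by
  let b := (headContraction θ φ).domDomCongr (finCongr (Nat.add_comm q 2))
  let s : Equiv.Perm (Fin (2 + q)) := Equiv.swap (Fin.castAdd q 0) (Fin.castAdd q 1)
  have hb (v : Fin (2 + q) → V N) : b v = φ (Matrix.vecCons
      (θ (v (Fin.castAdd q 0)) (v (Fin.castAdd q 1))) fun j => v (Fin.natAdd 2 j)) := by
    simp only [b, MultilinearMap.domDomCongr_apply, headContraction_apply]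
    congr! 2
    funext j
    congr 1
    ext
    simp only [finCongr_apply, Fin.val_cast, Fin.val_succ, Fin.val_natAdd]
    omega
  have hs : Equiv.Perm.sign s = -1 := Equiv.Perm.sign_swap (by simp [Fin.ext_iff])
  choose w hw using fun j : Fin N =>
    exists_multilinear_smul (component j (skewPart θ)) (φ.toAlternatingMap.curryLeft (e j))
  -- Before alternatization: `∑ⱼ T^j ⊗ ι_{e_j} φ` is `ι_T φ`, with `T(v₀, v₁) = θ(v₀)v₁ - θ(v₁)v₀`.
  have hsum : ∑ j, w j = b - b.domDomCongr s := by
    ext v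
    have h0 : (b - b.domDomCongr s) v = b v - b (fun a => v (s a)) := rfl
    have e1 : s (Fin.castAdd q 0) = Fin.castAdd q 1 := Equiv.swap_apply_left _ _
    have e2 : s (Fin.castAdd q 1) = Fin.castAdd q 0 := Equiv.swap_apply_right _ _
    have e3 (a : Fin q) : s (Fin.natAdd 2 a) = Fin.natAdd 2 a :=
      Equiv.swap_apply_of_ne_of_ne (by simp [Fin.ext_iff]) (by simp [Fin.ext_iff]; omega)
    have h1 : b (fun a => v (s a)) = φ (Matrix.vecCons
        (θ (v (Fin.castAdd q 1)) (v (Fin.castAdd q 0))) fun j => v (Fin.natAdd 2 j)) := by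
      rw [hb, e1, e2]
      exact congrArg (fun w => φ (Matrix.vecCons _ w)) (funext fun j => congrArg v (e3 j))
    rw [sum_apply, h0, h1, hb]
    let x : V N := skewPart θ fun a => v (Fin.castAdd q a)
    have hx : x = ∑ j, x j • (e j : V N) := by
      simpa using ((EuclideanSpace.basisFun (Fin N) ℝ).sum_repr x).symm
    have hx' : x = θ (v (Fin.castAdd q 0)) (v (Fin.castAdd q 1)) -
      θ (v (Fin.castAdd q 1)) (v (Fin.castAdd q 0)) := skewPart_apply _ _
    have h4 : φ.toAlternatingMap.curryLeft x = ∑ j, x j • φ.toAlternatingMap.curryLeft (e j) := by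
      conv_lhs => rw [hx]
      simp only [map_sum, map_smul]
    have h5 : φ.toAlternatingMap.curryLeft x (fun a => v (Fin.natAdd 2 a)) = φ (Matrix.vecCons
        (θ (v (Fin.castAdd q 0)) (v (Fin.castAdd q 1))) fun j => v (Fin.natAdd 2 j)) -
        φ (Matrix.vecCons
        (θ (v (Fin.castAdd q 1)) (v (Fin.castAdd q 0))) fun j => v (Fin.natAdd 2 j)) := by
      rw [hx', map_sub]
      rfl
    let ev : (V N [⋀^Fin q]→ₗ[ℝ] ℝ) →ₗ[ℝ] ℝ :=
      { toFun := fun β => β fun a => v (Fin.natAdd 2 a)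
        map_add' := fun _ _ => rfl
        map_smul' := fun _ _ => rfl }
    rw [← h5, h4]
    refine Eq.trans ?_ (map_sum ev _ _).symm
    exact Finset.sum_congr rfl fun j _ => hw j v
  rw [Finset.smul_sum, Finset.sum_congr rfl fun j _ => factorial_smul_wedge _ _ (w j) (hw j),
    ← map_sum, hsum, map_sub, alternatization_domDomCongr_perm, hs, alternatization_domDomCongr]
  simp [two_smul]

/-- Both sides are nonzero multiples of the alternatization of `headContraction θ φ`. This
identifies the kernel condition for `A²` with the vanishing of the expression that computes `dΦ`. -/
lemma sum_wedge_skewPart_eq_zero_iff {N k : ℕ} (θ : V N →L[ℝ] V N →L[ℝ] V N)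
    (φ : V N [⋀^Fin k]→L[ℝ] ℝ) :
    ∑ j, wedge (component j (skewPart θ)) (interiorProd (e j) φ.toAlternatingMap) = 0 ↔
      AlternatingMap.alternatizeUncurryFin (infActMap θ φ) = 0 := by
  cases k with
  | zero =>
    -- On a `0`-form the interior product is zero by convention and the action is an empty sum.
    refine iff_of_true (Finset.sum_eq_zero fun j _ => ?_) ?_
    · change wedge _ (0 : V N [⋀^Fin 0]→ₗ[ℝ] ℝ) = 0
      simpa using wedge_sum_right (component j (skewPart θ)) (fun _ : Fin N => (0 : ℝ))
        (fun _ => (0 : V N [⋀^Fin 0]→ₗ[ℝ] ℝ))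
    · ext v
      simp [AlternatingMap.alternatizeUncurryFin_apply, infActMap, infAct_apply]
  | succ q =>
    have h1 := sum_wedge_skewPart_eq θ φ
    have h2 := factorial_smul_alternatize_infActMap θ φ
    have c1 : Nat.factorial 2 * q.factorial ≠ 0 := by positivity
    have c2 : (q + 2).factorial ≠ 0 := by positivity
    have e1 := (smul_eq_zero_iff_right c1).symm.trans
      ((Eq.congr_left h1).trans (smul_eq_zero_iff_right two_ne_zero))
    have e2 := (smul_eq_zero_iff_right c2).symm.trans
      ((Eq.congr_left h2).trans (smul_eq_zero_iff_right (by positivity)))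
    exact e1.trans ((AlternatingMap.domDomCongr_eq_zero_iff _ _).trans e2.symm)

/-! ### The Lie algebra of the isotropy group -/

section LieAlgebra

variable {N k l : ℕ} {p : Fin l → ℕ}

lemma exp_zero_smul_apply (X : V N →L[ℝ] V N) (u : V N) :
    NormedSpace.exp ((0 : ℝ) • X) u = u := by
  have h : NormedSpace.exp ((0 : ℝ) • X) = 1 := by
    have h0 : (0 : ℝ) • X = 0 := zero_smul ℝ X
    rw [h0, NormedSpace.exp_zero]
  rw [h]
  rfl

/-- Needed at every `t`: at `t = 0` it shows that `𝔤` annihilates `Φ^V`, and at all `t` that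
annihilation makes `Φ^V` constant along the one-parameter group. -/
lemma hasDerivAt_exp_comp (φ : V N [⋀^Fin k]→L[ℝ] ℝ) (X : V N →L[ℝ] V N) (v : Fin k → V N)
    (t : ℝ) :
    HasDerivAt (fun t : ℝ => φ fun j => NormedSpace.exp (t • X) (v j))
      (infAct φ X fun j => NormedSpace.exp (t • X) (v j)) t := by
  have h1 (j : Fin k) : HasDerivAt (fun t : ℝ => NormedSpace.exp (t • X) (v j))
      (X (NormedSpace.exp (t • X) (v j))) t := by
    have h := hasDerivAt_exp_smul_const' (𝕂 := ℝ) X t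
    exact (h.clm_apply (hasDerivAt_const t (v j))).congr_deriv (by simp)
  have h2 := (φ.hasFDerivAt fun j => NormedSpace.exp (t • X) (v j)).comp_hasDerivAt t
    (hasDerivAt_pi.mpr h1)
  refine h2.congr_deriv ?_
  rw [infAct_apply]
  simp [ContinuousMultilinearMap.linearDeriv_apply]

/-- The Lie algebra of the isotropy group consists of the endomorphisms that annihilate `Φ^V`. -/
lemma mem_lieAlg_stabilizer_iff (ΦV : ∀ i, V N [⋀^Fin (p i)]→L[ℝ] ℝ) (X : V N →L[ℝ] V N) :
    X ∈ lieAlg (stabilizer ΦV) ↔ ∀ i, infAct (ΦV i) X = 0 := by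
  constructor
  · intro hX i
    ext v
    have h := hasDerivAt_exp_comp (ΦV i) X v 0
    have hc : (fun t : ℝ => ΦV i fun j => NormedSpace.exp (t • X) (v j)) = fun _ => ΦV i v := by
      funext t
      obtain ⟨g, hg, hgX⟩ := hX t
      have h2 := congrArg (fun α => α fun j => NormedSpace.exp (t • X) (v j)) (hg i)
      rw [← hgX] at h2 ⊢
      simpa [push, Function.comp_def] using h2.symm
    rw [hc] at h
    have h2 := h.unique (hasDerivAt_const (0 : ℝ) (ΦV i v))
    simp only [exp_zero_smul_apply] at h2
    exact h2
  · intro hX t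
    have hunit : IsUnit (NormedSpace.exp (t • X)) :=
      NormedSpace.isUnit_exp_of_mem_ball (𝕂 := ℝ) (by simp [NormedSpace.expSeries_radius_eq_top])
    obtain ⟨u, hu⟩ := hunit
    let g := ContinuousLinearEquiv.unitsEquiv ℝ (V N) u
    have hg : (g : V N →L[ℝ] V N) = NormedSpace.exp (t • X) := by rw [← hu]; rfl
    refine ⟨g, fun i => ?_, hg⟩
    have hconst (v : Fin (p i) → V N) :
        ΦV i (fun j => NormedSpace.exp (t • X) (v j)) = ΦV i v := by
      have h := is_const_of_deriv_eq_zero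
        (f := fun t : ℝ => ΦV i fun j => NormedSpace.exp (t • X) (v j))
        (fun s => (hasDerivAt_exp_comp (ΦV i) X v s).differentiableAt)
        (fun s => by rw [(hasDerivAt_exp_comp (ΦV i) X v s).deriv, hX i]; rfl) t 0
      simpa only [exp_zero_smul_apply] using h
    ext v
    have h := hconst fun j => g.symm (v j)
    rw [← hg] at h
    simpa [push, Function.comp_def] using h.symm

lemma inner_add_inner_eq_zero_of_mem_lieAlg {G : Subgroup (V N ≃L[ℝ] V N)}
    (hG : G ≤ orthogonal N) {X : V N →L[ℝ] V N} (hX : X ∈ lieAlg G) (v w : V N) :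
    inner ℝ (X v) w + inner ℝ v (X w) = 0 := by
  have h1 (u : V N) : HasDerivAt (fun t : ℝ => NormedSpace.exp (t • X) u) (X u) 0 := by
    have h := hasDerivAt_exp_smul_const' (𝕂 := ℝ) X (0 : ℝ)
    exact (h.clm_apply (hasDerivAt_const _ u)).congr_deriv (by simp [exp_zero_smul_apply])
  have h2 := (h1 v).inner ℝ (h1 w)
  have hc : (fun t : ℝ => inner ℝ (NormedSpace.exp (t • X) v) (NormedSpace.exp (t • X) w)) =
      fun _ => inner ℝ v w := by
    funext t
    obtain ⟨g, hg, hgX⟩ := hX t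
    rw [← hgX]
    exact hG hg v w
  rw [hc] at h2
  have h3 := h2.unique (hasDerivAt_const (0 : ℝ) (inner ℝ v w))
  simp only [exp_zero_smul_apply] at h3
  linarith

/-- The first prolongation of `𝔰𝔬(N)` vanishes. -/
lemma eq_zero_of_symm_of_skew (θ : V N →L[ℝ] V N →L[ℝ] V N) (hs : ∀ a b, θ a b = θ b a)
    (hk : ∀ a v w, inner ℝ (θ a v) w + inner ℝ v (θ a w) = 0) : θ = 0 := by
  ext1 a
  ext1 b
  refine ext_inner_right ℝ fun c => ?_
  -- With `x = ⟨θ_a b, c⟩`, `y = ⟨θ_a c, b⟩`, `z = ⟨θ_b c, a⟩`, skewness and symmetry give `x + y =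
  -- z + x = y + z = 0`, so `x = 0`.
  have h1 := hk a b c
  have h2 := hk b c a
  have h3 := hk c a b
  rw [hs b c, real_inner_comm] at h2
  rw [hs c a, hs c b] at h3
  rw [hs b a, real_inner_comm (θ a b), hs c b] at h2
  rw [real_inner_comm] at h3
  simp only [zero_apply, inner_zero_left]
  have h4 : inner ℝ (θ a c) b = inner ℝ b (θ a c) := real_inner_comm _ _
  have h5 : inner ℝ (θ b c) a = inner ℝ a (θ b c) := real_inner_comm _ _
  linarith

end LieAlgebra

/-! ### Dimensions of 𝔤² and of its orthogonal complement -/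

section Dimension

variable {N : ℕ}

instance finiteDimensional_alternatingMap {k : ℕ} {W : Type*} [AddCommGroup W] [Module ℝ W]
    [FiniteDimensional ℝ W] : FiniteDimensional ℝ (V N [⋀^Fin k]→ₗ[ℝ] W) :=
  Module.Finite.of_injective
    (AlternatingMap.toMultilinearMapLM (R := ℝ) (S := ℝ) (M := V N) (N := W) (ι := Fin k))
    AlternatingMap.coe_multilinearMap_injective

/-- `formInner` as a bilinear form. -/
def formInnerBilin (N k : ℕ) : LinearMap.BilinForm ℝ (V N [⋀^Fin k]→ₗ[ℝ] V N) :=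
  LinearMap.mk₂ ℝ formInner
    (fun S S' T => by simp [formInner, inner_add_left, Finset.sum_add_distrib, add_div])
    (fun c S T => by simp [formInner, inner_smul_left, ← Finset.mul_sum, mul_div_assoc])
    (fun S T T' => by simp [formInner, inner_add_right, Finset.sum_add_distrib, add_div])
    (fun c S T => by simp [formInner, inner_smul_right, ← Finset.mul_sum, mul_div_assoc])

lemma eq_zero_of_formInner_self_eq_zero {k : ℕ} (T : V N [⋀^Fin k]→ₗ[ℝ] V N)
    (h : formInner T T = 0) : T = 0 := by
  have hk : (k.factorial : ℝ) ≠ 0 := by positivity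
  rw [formInner, div_eq_zero_iff, or_iff_left hk,
    Finset.sum_eq_zero_iff_of_nonneg fun J _ => real_inner_self_nonneg] at h
  refine AlternatingMap.coe_multilinearMap_injective
    (Module.Basis.ext_multilinear (fun _ => (EuclideanSpace.basisFun (Fin N) ℝ).toBasis) fun J => ?_)
  have := h J (Finset.mem_univ _)
  rw [inner_self_eq_zero] at this
  simpa using this

lemma finrank_gSucc_add_finrank_PSucc (G : Subgroup (V N ≃L[ℝ] V N)) (k : ℕ) :
    Module.finrank ℝ (gSucc G k) + Module.finrank ℝ (PSucc G k) =
      Module.finrank ℝ (V N [⋀^Fin (k + 1)]→ₗ[ℝ] V N) := by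
  let B := formInnerBilin N (k + 1)
  have hP : PSucc G k = B.orthogonal (gSucc G k) := by
    ext T
    rfl
  have hsymm : B.IsRefl := fun S T h => by
    have : formInner T S = formInner S T := by
      simp only [formInner, real_inner_comm]
    exact this.trans h
  have hc : IsCompl (gSucc G k) (B.orthogonal (gSucc G k)) := by
    rw [LinearMap.BilinForm.isCompl_orthogonal_iff_disjoint hsymm, Submodule.disjoint_def]
    exact fun T hT hT' => eq_zero_of_formInner_self_eq_zero T (hT' T hT)
  rw [hP]
  exact Submodule.finrank_add_eq_of_isCompl hc

end Dimension

/-! ### The kernel of A² and 𝔤-valued connection forms -/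

section Torsion

variable {N l : ℕ} {p : Fin l → ℕ}

/-- `α ⊗ a ∈ V^* ⊗ End(V)` for `α ∈ Λ¹`. -/
def oneFormSmul (α : V N [⋀^Fin 1]→ₗ[ℝ] ℝ) (a : V N →L[ℝ] V N) :
    V N →L[ℝ] V N →L[ℝ] V N :=
  ((AlternatingMap.ofSubsingleton ℝ (V N) ℝ (0 : Fin 1)).symm α).toContinuousLinearMap.smulRight a

lemma oneFormSmul_apply (α : V N [⋀^Fin 1]→ₗ[ℝ] ℝ) (a : V N →L[ℝ] V N) (v : V N) :
    oneFormSmul α a v = α (fun _ => v) • a := rfl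

/-- Lets generators of `𝔤²` be handled as skew parts of `𝔤`-valued maps. Twice either side is twice
the alternatization of the same bilinear map. -/
lemma wedge_ofSubsingleton (α : V N [⋀^Fin 1]→ₗ[ℝ] ℝ) (a : V N →L[ℝ] V N) :
    wedge α (AlternatingMap.ofSubsingleton ℝ (V N) (V N) (0 : Fin 1) a.toLinearMap) =
      skewPart (oneFormSmul α a) := by
  obtain ⟨w, hw⟩ := exists_multilinear_smul α
    (AlternatingMap.ofSubsingleton ℝ (V N) (V N) (0 : Fin 1) a.toLinearMap)
  have h1 := factorial_smul_wedge α
    (AlternatingMap.ofSubsingleton ℝ (V N) (V N) (0 : Fin 1) a.toLinearMap) w hw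
  have h2 := factorial_smul_alternatizeUncurryFin
    { toFun := fun v => AlternatingMap.ofSubsingleton ℝ (V N) (V N) (0 : Fin 1)
        (oneFormSmul α a v).toLinearMap
      map_add' := fun v w => by ext; simp
      map_smul' := fun c v => by ext; simp } w
    (fun v => by
      have hv : (fun i : Fin 1 => v (Fin.castAdd 1 i)) = fun _ => v 0 := by
        funext i
        rw [Subsingleton.elim i 0]
        rfl
      rw [hw, hv]
      rfl)
  simp only [Nat.factorial_one, mul_one, one_smul] at h1
  rw [h1]
  change (2 : ℕ) • skewPart (oneFormSmul α a) = (2 : ℕ) • _ at h2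
  refine AlternatingMap.ext fun v => ?_
  have h3 : (2 : ℕ) • skewPart (oneFormSmul α a) v =
      (2 : ℕ) • MultilinearMap.alternatization w v := congrArg (fun T => T v) h2
  rw [← Nat.cast_smul_eq_nsmul ℝ, ← Nat.cast_smul_eq_nsmul ℝ] at h3
  exact (smul_right_injective (V N) (Nat.cast_ne_zero.mpr two_ne_zero : ((2 : ℕ) : ℝ) ≠ 0) h3).symm

/-- If `a` annihilates `Φ^V`, so does every value of `α ⊗ a`; its action vanishes even before
alternation. -/
lemma gSucc_le_ker_A (ΦV : ∀ i, V N [⋀^Fin (p i)]→L[ℝ] ℝ) :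
    gSucc (stabilizer ΦV) 1 ≤ LinearMap.ker (A ΦV 2) := by
  refine Submodule.span_le.mpr ?_
  rintro T ⟨α, a, ha, rfl⟩
  rw [mem_lieAlg_stabilizer_iff] at ha
  rw [wedge_ofSubsingleton]
  refine LinearMap.mem_ker.mpr (funext fun i => (sum_wedge_skewPart_eq_zero_iff _ _).mpr ?_)
  have h : infActMap (oneFormSmul α a) (ΦV i) = 0 := by
    ext1 v
    change (infAct (ΦV i) (α (fun _ => v) • a)).toAlternatingMap = 0
    rw [map_smul, ha i, smul_zero]
    rfl
  rw [h]
  ext v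
  simp [AlternatingMap.alternatizeUncurryFin_apply]

/-- Rank–nullity for `A²` and the splitting `𝔤² ⊕ P²` of the same space: equal dimensions of `E²`
and `P²` force equal dimensions of `ker A²` and `𝔤²`. -/
lemma gSucc_eq_ker_A (ΦV : ∀ i, V N [⋀^Fin (p i)]→L[ℝ] ℝ)
    (hdim : Module.finrank ℝ (E ΦV 2) = Module.finrank ℝ (PSucc (stabilizer ΦV) 1)) :
    gSucc (stabilizer ΦV) 1 = LinearMap.ker (A ΦV 2) := by
  refine Submodule.eq_of_le_of_finrank_eq (gSucc_le_ker_A ΦV) ?_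
  have h1 := finrank_gSucc_add_finrank_PSucc (stabilizer ΦV) 1
  have h2 := LinearMap.finrank_range_add_finrank_ker (A ΦV 2)
  have h3 : Module.finrank ℝ (LinearMap.range (A ΦV 2)) =
    Module.finrank ℝ (PSucc (stabilizer ΦV) 1) := hdim
  rw [h3, add_comm] at h2
  exact Nat.add_right_cancel (h1.trans h2.symm)

lemma exists_skewPart_eq_of_mem_gSucc (ΦV : ∀ i, V N [⋀^Fin (p i)]→L[ℝ] ℝ)
    {T : V N [⋀^Fin 2]→ₗ[ℝ] V N} (hT : T ∈ gSucc (stabilizer ΦV) 1) :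
    ∃ η : V N →L[ℝ] V N →L[ℝ] V N, (∀ a, η a ∈ lieAlg (stabilizer ΦV)) ∧ skewPart η = T := by
  -- `lieAlg` is only a set; as an annihilator it is visibly closed under linear combinations.
  simp only [mem_lieAlg_stabilizer_iff]
  induction hT using Submodule.span_induction with
  | mem T h =>
    obtain ⟨α, a, ha, rfl⟩ := h
    rw [mem_lieAlg_stabilizer_iff] at ha
    refine ⟨oneFormSmul α a, fun v i => ?_, (wedge_ofSubsingleton α a).symm⟩
    rw [oneFormSmul_apply, map_smul, ha i, smul_zero]
  | zero =>
    refine ⟨0, fun v i => map_zero _, ?_⟩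
    ext1 v
    simp [skewPart_apply]
  | add T T' _ _ h h' =>
    obtain ⟨η, hη, rfl⟩ := h
    obtain ⟨η', hη', rfl⟩ := h'
    refine ⟨η + η', fun v i => ?_, ?_⟩
    · rw [add_apply, map_add, hη, hη', add_zero]
    · ext1 v
      simp only [skewPart_apply, AlternatingMap.add_apply, add_apply]
      abel
  | smul c T _ h =>
    obtain ⟨η, hη, rfl⟩ := h
    refine ⟨c • η, fun v i => ?_, ?_⟩
    · rw [smul_apply, map_smul, hη, smul_zero]
    · ext1 v
      simp only [skewPart_apply, AlternatingMap.smul_apply, smul_apply, smul_sub]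

/-- An `𝔰𝔬(N)`-valued `θ` whose alternated action on `Φ^V` vanishes is `𝔤`-valued. -/
lemma mem_lieAlg_of_alternatize_eq_zero (ΦV : ∀ i, V N [⋀^Fin (p i)]→L[ℝ] ℝ)
    (hG : stabilizer ΦV ≤ orthogonal N)
    (hdim : Module.finrank ℝ (E ΦV 2) = Module.finrank ℝ (PSucc (stabilizer ΦV) 1))
    (θ : V N →L[ℝ] V N →L[ℝ] V N)
    (hk : ∀ a v w, inner ℝ (θ a v) w + inner ℝ v (θ a w) = 0)
    (hθ : ∀ i, AlternatingMap.alternatizeUncurryFin (infActMap θ (ΦV i)) = 0) (a : V N) :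
    θ a ∈ lieAlg (stabilizer ΦV) := by
  have h1 : skewPart θ ∈ gSucc (stabilizer ΦV) 1 := by
    rw [gSucc_eq_ker_A ΦV hdim, LinearMap.mem_ker]
    exact funext fun i => (sum_wedge_skewPart_eq_zero_iff _ _).mpr (hθ i)
  obtain ⟨η, hη, hT⟩ := exists_skewPart_eq_of_mem_gSucc ΦV h1
  -- Equal skew parts make `θ - η` symmetric, and both terms are `𝔰𝔬(N)`-valued.
  have h2 : θ - η = 0 := by
    refine eq_zero_of_symm_of_skew _ (fun a b => ?_) fun a v w => ?_
    · have h3 := congrArg (fun T => T ![a, b]) hT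
      simp only [skewPart_apply] at h3
      simp only [sub_apply]
      change η a b - η b a = θ a b - θ b a at h3
      rw [sub_eq_sub_iff_add_eq_add] at h3 ⊢
      rw [add_comm (θ b a), h3]
    · have h3 := hk a v w
      have h4 := inner_add_inner_eq_zero_of_mem_lieAlg hG (hη a) v w
      simp only [sub_apply, inner_sub_left, inner_sub_right]
      linarith
  have h3 : θ = η := sub_eq_zero.mp h2
  exact h3 ▸ hη a

/-- The alternated action of a symmetric `Γ` vanishes. -/
lemma alternatize_infActMap_of_symm {k : ℕ} (Γ : V N →L[ℝ] V N →L[ℝ] V N)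
    (φ : V N [⋀^Fin k]→L[ℝ] ℝ) (hs : ∀ a b, Γ a b = Γ b a) :
    AlternatingMap.alternatizeUncurryFin (infActMap Γ φ) = 0 := by
  rw [← sum_wedge_skewPart_eq_zero_iff]
  have h : skewPart Γ = 0 := by
    ext1 v
    rw [skewPart_apply, hs, sub_self]
    rfl
  refine Finset.sum_eq_zero fun j _ => ?_
  rw [h, map_zero]
  simpa using wedge_smul_left 0 (0 : V N [⋀^Fin 2]→ₗ[ℝ] ℝ) (interiorProd (e j) φ.toAlternatingMap)

end Torsion

/-! ### Calculus in charts and smooth local frames -/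

section LocalFrame

open Bundle Filter Topology

variable {N : ℕ} {M : Type*} [TopologicalSpace M] [ChartedSpace (V N) M]

lemma eq_sum_smul_e (v : V N) : v = ∑ j, v j • (e j : V N) := by
  simpa using ((EuclideanSpace.basisFun (Fin N) ℝ).sum_repr v).symm

section Chart

variable {F : Type*} [NormedAddCommGroup F] [NormedSpace ℝ F]

lemma mdifferentiableAt_iff_chart {f : M → F} {x : M} :
    MDifferentiableAt (𝓡 N) 𝓘(ℝ, F) f x ↔
      DifferentiableAt ℝ (f ∘ (extChartAt (𝓡 N) x).symm) (extChartAt (𝓡 N) x x) := by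
  rw [mdifferentiableAt_iff]
  have h : DifferentiableWithinAt ℝ (writtenInExtChartAt (𝓡 N) 𝓘(ℝ, F) x f)
      (Set.range (𝓡 N)) (extChartAt (𝓡 N) x x) ↔
      DifferentiableAt ℝ (f ∘ (extChartAt (𝓡 N) x).symm) (extChartAt (𝓡 N) x x) := by
    rw [ModelWithCorners.Boundaryless.range_eq_univ, differentiableWithinAt_univ]
    rfl
  rw [h]
  refine ⟨And.right, fun hd => ⟨?_, hd⟩⟩
  have hc : ContinuousAt ((f ∘ (extChartAt (𝓡 N) x).symm) ∘ extChartAt (𝓡 N) x) x :=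
    hd.continuousAt.comp (continuousAt_extChartAt x)
  refine hc.congr ?_
  filter_upwards [extChartAt_source_mem_nhds (I := 𝓡 N) x] with y hy
  simp only [Function.comp_apply]
  rw [(extChartAt (𝓡 N) x).left_inv hy]

/-- `T_x M` is identified with `V` by the chart at `x` itself, so `v` needs no change of
coordinates. -/
lemma mvfderiv_eq_fderiv_chart {f : M → F} {x : M}
    (hf : MDifferentiableAt (𝓡 N) 𝓘(ℝ, F) f x) (v : V N) :
    mvfderiv (𝓡 N) f x v =
      fderiv ℝ (f ∘ (extChartAt (𝓡 N) x).symm) (extChartAt (𝓡 N) x x) v := by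
  have h : mfderiv (𝓡 N) 𝓘(ℝ, F) f x = fderivWithin ℝ (writtenInExtChartAt (𝓡 N) 𝓘(ℝ, F) x f)
      (Set.range (𝓡 N)) (extChartAt (𝓡 N) x x) := hf.mfderiv
  change mfderiv (𝓡 N) 𝓘(ℝ, F) f x v = _
  rw [h, ModelWithCorners.Boundaryless.range_eq_univ, fderivWithin_univ]
  rfl

lemma mvfderiv_congr {f g : M → F} {x : M} (h : f =ᶠ[𝓝 x] g) :
    mvfderiv (𝓡 N) f x = mvfderiv (𝓡 N) g x := by
  ext v
  change mfderiv (𝓡 N) 𝓘(ℝ, F) f x v = mfderiv (𝓡 N) 𝓘(ℝ, F) g x v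
  rw [h.mfderiv_eq]
  rfl

lemma differentiableAt_of_apply {E' : Type*} [NormedAddCommGroup E'] [NormedSpace ℝ E']
    {L : E' → V N →L[ℝ] F} {z : E'}
    (h : ∀ w, DifferentiableAt ℝ (fun z => L z w) z) : DifferentiableAt ℝ L z := by
  have hL : L = fun z => ∑ j, (EuclideanSpace.proj (𝕜 := ℝ) j : V N →L[ℝ] ℝ).smulRight
      (L z (e j)) := by
    funext z
    ext w
    conv_lhs => rw [eq_sum_smul_e w, map_sum]
    simp
  rw [hL]
  refine DifferentiableAt.fun_sum fun j _ => ?_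
  exact ((ContinuousLinearMap.smulRightL ℝ (V N) F
    (EuclideanSpace.proj (𝕜 := ℝ) j)).differentiableAt).comp z (h (e j))

end Chart

variable [IsManifold (𝓡 N) ∞ M]

lemma SmoothFrameOn.fieldDiffAt {τ : ∀ y : M, Frame N y} {U : Set M} (hτ : SmoothFrameOn τ U)
    (hU : IsOpen U) {x : M} (hx : x ∈ U) (w : V N) : FieldDiffAt (fun y => τ y w) x :=
  ((hτ w).contMDiffAt (hU.mem_nhds hx)).mdifferentiableAt (by simp)

/-- The coordinates of a differentiable vector field in a smooth frame are differentiable. -/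
lemma SmoothFrameOn.mdifferentiableAt_coord {τ : ∀ y : M, Frame N y} {U : Set M}
    (hτ : SmoothFrameOn τ U) (hU : IsOpen U) {x : M} (hx : x ∈ U)
    {Y : ∀ y : M, TangentSpace (𝓡 N) y} (hY : FieldDiffAt Y x) :
    MDifferentiableAt (𝓡 N) 𝓘(ℝ, V N) (fun y => (τ y).symm (Y y)) x := by
  let t := trivializationAt (V N) (TangentSpace (𝓡 N) : M → Type _) x
  have hxt : x ∈ t.baseSet := FiberBundle.mem_baseSet_trivializationAt' x
  -- The frame read in the trivialization at `x`. The coordinates of `Y` are `L⁻¹` applied to the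
  -- trivialized `Y`, and inversion of operators is smooth at invertible ones.
  let L : M → V N →L[ℝ] V N := fun y => (t.continuousLinearMapAt ℝ y).comp (τ y : V N →L[ℝ] _)
  have hLapp (Z : ∀ y : M, TangentSpace (𝓡 N) y) (hZ : FieldDiffAt Z x) :
      MDifferentiableAt (𝓡 N) 𝓘(ℝ, V N) (fun y => t.continuousLinearMapAt ℝ y (Z y)) x := by
    have h := (mdifferentiableAt_section (𝓡 N) Z).mp hZ
    refine h.congr_of_eventuallyEq ?_
    filter_upwards [t.open_baseSet.mem_nhds hxt] with y hy
    rw [← t.coe_continuousLinearEquivAt_eq (R := ℝ) hy]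
    rfl
  have hL : MDifferentiableAt (𝓡 N) 𝓘(ℝ, V N →L[ℝ] V N) L x := by
    rw [mdifferentiableAt_iff_chart]
    refine differentiableAt_of_apply fun w => ?_
    exact mdifferentiableAt_iff_chart.mp (hLapp _ (hτ.fieldDiffAt hU hx w))
  have hLe (y : M) (hy : y ∈ t.baseSet) :
      L y = ((τ y).trans (t.continuousLinearEquivAt ℝ y hy) : V N ≃L[ℝ] V N) := by
    ext1 w
    exact (congrFun (t.coe_continuousLinearEquivAt_eq (R := ℝ) hy) (τ y w)).symm
  have hinv : MDifferentiableAt (𝓡 N) 𝓘(ℝ, V N →L[ℝ] V N) (fun y => (L y).inverse) x := by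
    have h := (contDiffAt_map_inverse (𝕜 := ℝ) (n := 1)
      ((τ x).trans (t.continuousLinearEquivAt ℝ x hxt) : V N ≃L[ℝ] V N)).differentiableAt
      one_ne_zero
    rw [← hLe x hxt] at h
    exact h.comp_mdifferentiableAt hL
  refine (hinv.clm_apply (hLapp Y hY)).congr_of_eventuallyEq ?_
  filter_upwards [t.open_baseSet.mem_nhds hxt] with y hy
  rw [hLe y hy, ContinuousLinearMap.inverse_equiv, ← t.coe_continuousLinearEquivAt_eq (R := ℝ) hy]
  change _ = (τ y).symm ((t.continuousLinearEquivAt ℝ y hy).symm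
    ((t.continuousLinearEquivAt ℝ y hy) (Y y)))
  rw [ContinuousLinearEquiv.symm_apply_apply]

lemma connection_sum (nabla : Connection N M) {ι : Type*} (s : Finset ι)
    (Y : ι → ∀ y : M, TangentSpace (𝓡 N) y) {x : M} (hY : ∀ j, FieldDiffAt (Y j) x) :
    nabla (fun y => ∑ j ∈ s, Y j y) x = ∑ j ∈ s, nabla (Y j) x := by
  classical
  induction s using Finset.induction_on with
  | empty => exact congrFun nabla.zero x
  | insert a s ha ih =>
    simp only [Finset.sum_insert ha]
    rw [← ih]
    exact nabla.isCovariantDerivativeOnUniv.add (hY a)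
      (MDifferentiableAt.sum_section fun j _ => hY j)

/-- The connection form of `∇` at `x` in a smooth local frame. -/
lemma SmoothFrameOn.exists_connectionForm {τ : ∀ y : M, Frame N y} {U : Set M}
    (hτ : SmoothFrameOn τ U) (hU : IsOpen U) {x : M} (hx : x ∈ U) (nabla : Connection N M) :
    ∃ θ : V N →L[ℝ] V N →L[ℝ] V N, ∀ Y : ∀ y : M, TangentSpace (𝓡 N) y, FieldDiffAt Y x →
      ∀ a : V N, nabla Y x (τ x a) =
        τ x (mvfderiv (𝓡 N) (fun y => (τ y).symm (Y y)) x (τ x a) + θ a ((τ x).symm (Y x))) := by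
  -- Prescribed on the frame fields `τ e_j` and extended linearly; the Leibniz rule applied to `Y =
  -- ∑ⱼ fʲ τ e_j` yields the formula.
  let Θ : V N →ₗ[ℝ] V N →ₗ[ℝ] V N := LinearMap.mk₂ ℝ
    (fun a w => ∑ j, w j • (τ x).symm (nabla (fun y => τ y (e j)) x (τ x a)))
    (fun a a' w => by simp only [map_add, smul_add, Finset.sum_add_distrib])
    (fun c a w => by simp only [map_smul, Finset.smul_sum, smul_comm c])
    (fun a w w' => by simp only [PiLp.add_apply, add_smul, Finset.sum_add_distrib])
    (fun c a w => by simp only [PiLp.smul_apply, smul_assoc, Finset.smul_sum])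
  refine ⟨Θ.toContinuousBilinearMap, fun Y hY a => ?_⟩
  have hf := hτ.mdifferentiableAt_coord hU hx hY
  set f : M → V N := fun y => (τ y).symm (Y y) with hfdef
  have hfj (j : Fin N) : MDifferentiableAt (𝓡 N) 𝓘(ℝ) (fun y => f y j) x :=
    (EuclideanSpace.proj (𝕜 := ℝ) j : V N →L[ℝ] ℝ).differentiableAt.comp_mdifferentiableAt hf
  have hdfj (j : Fin N) (v : TangentSpace (𝓡 N) x) :
      mvfderiv (𝓡 N) (fun y => f y j) x v = (mvfderiv (𝓡 N) f x v) j := by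
    have h := mvfderiv_eq_fderiv_chart (hfj j) v
    refine h.trans ?_
    refine Eq.trans ?_ (congrArg (fun u : V N => u j) (mvfderiv_eq_fderiv_chart hf v)).symm
    have hd := mdifferentiableAt_iff_chart.mp hf
    have := ((EuclideanSpace.proj (𝕜 := ℝ) j : V N →L[ℝ] ℝ).hasFDerivAt.comp _
      hd.hasFDerivAt).fderiv
    exact congrArg (fun A => A v) this
  have hYsum : Y = fun y => ∑ j, ((fun y => f y j) • fun y => τ y (e j)) y := by
    funext y
    have h1 : Y y = τ y (f y) := ((τ y).apply_symm_apply (Y y)).symm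
    rw [h1]
    conv_lhs => rw [eq_sum_smul_e (f y), map_sum]
    exact Finset.sum_congr rfl fun j _ => map_smul (τ y) _ _
  have hterm (j : Fin N) : FieldDiffAt ((fun y => f y j) • fun y => τ y (e j)) x :=
    MDifferentiableAt.smul_section (hfj j) (hτ.fieldDiffAt hU hx (e j))
  conv_lhs => rw [hYsum, connection_sum nabla _ _ hterm]
  rw [sum_apply, map_add]
  have hdf : τ x (mvfderiv (𝓡 N) f x (τ x a)) =
      ∑ j, mvfderiv (𝓡 N) (fun y => f y j) x (τ x a) • τ x (e j) := by
    conv_lhs => rw [eq_sum_smul_e (mvfderiv (𝓡 N) f x (τ x a)), map_sum]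
    exact Finset.sum_congr rfl fun j _ => by rw [map_smul, hdfj]
  have hth : τ x (Θ.toContinuousBilinearMap a (f x)) =
      ∑ j, f x j • nabla (fun y => τ y (e j)) x (τ x a) := by
    change τ x (∑ j, f x j • (τ x).symm (nabla (fun y => τ y (e j)) x (τ x a))) = _
    rw [map_sum]
    exact Finset.sum_congr rfl fun j _ => by rw [map_smul, (τ x).apply_symm_apply]
  rw [hdf, hth, ← Finset.sum_add_distrib]
  refine Finset.sum_congr rfl fun j _ => ?_
  rw [nabla.isCovariantDerivativeOnUniv.leibniz (hτ.fieldDiffAt hU hx (e j)) (hfj j)]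
  exact add_comm _ _

end LocalFrame

/-! ### Coordinate vector fields and the exterior derivative -/

section CoordinateField

open Bundle Filter Topology VectorField

variable {N : ℕ} {M : Type*} [TopologicalSpace M] [ChartedSpace (V N) M]
  [IsManifold (𝓡 N) ∞ M]

instance isManifold_minSmoothness_two : IsManifold (𝓡 N) (minSmoothness ℝ 2) M := by
  rw [minSmoothness_of_isRCLikeNormedField]
  exact IsManifold.of_le (n := ∞) (WithTop.coe_le_coe.mpr (le_top : (2 : ℕ∞) ≤ ⊤))

/-- A constant vector field on `V`. -/
def constField (c : V N) (z : V N) : TangentSpace 𝓘(ℝ, V N) z := c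

/-- The coordinate vector field in the chart at `x` with constant components `c`. -/
def coordField (x : M) (c : V N) : ∀ y : M, TangentSpace (𝓡 N) y :=
  mpullback (𝓡 N) 𝓘(ℝ, V N) (extChartAt (𝓡 N) x) (constField c)

lemma mdifferentiableAt_constField (c z : V N) :
    MDifferentiableAt 𝓘(ℝ, V N) 𝓘(ℝ, V N).tangent
      (fun y => (⟨y, constField c y⟩ : TangentBundle 𝓘(ℝ, V N) (V N))) z := by
  rw [mdifferentiableAt_section]
  simp only [trivializationAt_model_space_apply]
  exact mdifferentiableAt_const (c := c)

lemma fieldDiffAt_coordField (x : M) (c : V N) : FieldDiffAt (coordField x c) x :=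
  MDifferentiableAt.mpullback_vectorField (n := 2) (mdifferentiableAt_constField c _)
    contMDiffAt_extChartAt (isInvertible_mfderiv_extChartAt (mem_extChartAt_source x)) le_rfl

/-- Pullback by the chart commutes with brackets, and constant fields on `V` commute. -/
lemma mlieBracket_coordField (x : M) (c c' : V N) :
    mlieBracket (𝓡 N) (coordField x c) (coordField x c') x = 0 := by
  have h := mpullback_mlieBracket (n := minSmoothness ℝ 2) (x₀ := x) (I := 𝓡 N)
    (I' := 𝓘(ℝ, V N)) (f := extChartAt (𝓡 N) x)
    (mdifferentiableAt_constField c _) (mdifferentiableAt_constField c' _)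
    contMDiffAt_extChartAt le_rfl
  refine h.symm.trans ?_
  have h0 : mlieBracket 𝓘(ℝ, V N) (constField c) (constField c') = 0 := by
    rw [← mlieBracketWithin_univ, mlieBracketWithin_eq_lieBracketWithin]
    funext z
    change fderivWithin ℝ (fun _ : V N => c') _ z c - fderivWithin ℝ (fun _ : V N => c) _ z c' = 0
    simp
  rw [mpullback_apply, h0]
  exact map_zero _

lemma mfderiv_extChartAt_self (x : M) (v : V N) :
    mfderiv (𝓡 N) 𝓘(ℝ, V N) (extChartAt (𝓡 N) x) x v = v := by
  have hd : MDifferentiableAt (𝓡 N) 𝓘(ℝ, V N) (extChartAt (𝓡 N) x) x :=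
    mdifferentiableAt_extChartAt (ChartedSpace.mem_chart_source x)
  have h := mvfderiv_eq_fderiv_chart hd v
  refine Eq.trans h ?_
  have he : (extChartAt (𝓡 N) x ∘ (extChartAt (𝓡 N) x).symm) =ᶠ[𝓝 (extChartAt (𝓡 N) x x)] id := by
    filter_upwards [extChartAt_target_mem_nhds (I := 𝓡 N) x] with z hz
    exact (extChartAt (𝓡 N) x).right_inv hz
  rw [he.fderiv_eq, fderiv_id]
  rfl

lemma coordField_eq {x y : M} (hy : y ∈ (extChartAt (𝓡 N) x).source) (c : V N) :
    coordField x c y =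
      mfderiv 𝓘(ℝ, V N) (𝓡 N) (extChartAt (𝓡 N) x).symm (extChartAt (𝓡 N) x y) c := by
  have h := mfderiv_extChartAt_comp_mfderivWithin_extChartAt_symm' (I := 𝓡 N) hy
  refine (isInvertible_mfderiv_extChartAt hy).inverse_apply_eq.mpr ?_
  rw [ModelWithCorners.Boundaryless.range_eq_univ, mfderivWithin_univ] at h
  exact (congrArg (fun A => A c) h).symm

lemma coordField_self (x : M) (c : V N) : coordField x c x = c := by
  exact (isInvertible_mfderiv_extChartAt (mem_extChartAt_source x)).inverse_apply_eq.mpr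
    (mfderiv_extChartAt_self x c).symm

/-- The exterior derivative through coordinate vector fields. -/
lemma extDerivM_apply_coordField {τ : ∀ y : M, Frame N y} {U : Set M}
    (hτ : SmoothFrameOn τ U) (hU : IsOpen U) {x : M} (hx : x ∈ U) {k : ℕ}
    (φ : V N [⋀^Fin k]→L[ℝ] ℝ) (η : ∀ x : M, TangentSpace (𝓡 N) x [⋀^Fin k]→L[ℝ] ℝ)
    (hη : ∀ y ∈ U, η y = push (τ y) φ) (w : Fin (k + 1) → V N) :
    extDerivM η x w = ∑ i : Fin (k + 1), (-1) ^ (i : ℕ) •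
      mvfderiv (𝓡 N) (fun y => η y fun j => coordField x (i.removeNth w j) y) x (w i) := by
  let ψ := extChartAt (𝓡 N) x
  let α : V N → V N [⋀^Fin k]→L[ℝ] ℝ := fun z =>
    (η (ψ.symm z)).compContinuousLinearMap (mfderiv 𝓘(ℝ, V N) (𝓡 N) ψ.symm z)
  -- The coframe in the chart. Near `ψ x` the local form `α` is `φ` composed with `B`, which gives
  -- the differentiability that `extDeriv_apply` requires.
  let B : V N → V N →L[ℝ] V N := fun z =>
    ((τ (ψ.symm z)).symm : _ →L[ℝ] V N).comp (mfderiv 𝓘(ℝ, V N) (𝓡 N) ψ.symm z)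
  have htarget : ∀ᶠ z in 𝓝 (ψ x), z ∈ ψ.target := extChartAt_target_mem_nhds (I := 𝓡 N) x
  have hUz : ∀ᶠ z in 𝓝 (ψ x), ψ.symm z ∈ U := by
    have hc : ContinuousAt ψ.symm (ψ x) := continuousAt_extChartAt_symm x
    refine hc.eventually ?_
    have : ψ.symm (ψ x) = x := extChartAt_to_inv x
    rw [this]
    exact hU.mem_nhds hx
  have hcoord (z : V N) (hz : z ∈ ψ.target) (c : V N) :
      mfderiv 𝓘(ℝ, V N) (𝓡 N) ψ.symm z c = coordField x c (ψ.symm z) := by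
    rw [coordField_eq (ψ.map_target hz)]
    change _ = mfderiv 𝓘(ℝ, V N) (𝓡 N) ψ.symm (ψ (ψ.symm z)) c
    rw [ψ.right_inv hz]
  have hB : DifferentiableAt ℝ B (ψ x) := by
    refine differentiableAt_of_apply fun c => ?_
    have h := mdifferentiableAt_iff_chart.mp
      (hτ.mdifferentiableAt_coord hU hx (fieldDiffAt_coordField x c))
    refine h.congr_of_eventuallyEq ?_
    filter_upwards [htarget] with z hz
    exact congrArg (τ (ψ.symm z)).symm (hcoord z hz c)
  have hα : DifferentiableAt ℝ α (ψ x) := by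
    have h : DifferentiableAt ℝ (fun z => φ.compContinuousLinearMap (B z)) (ψ x) :=
      (differentiableAt_const φ).continuousAlternatingMapCompContinuousLinearMap hB
    refine h.congr_of_eventuallyEq ?_
    filter_upwards [hUz] with z hz
    change (η (ψ.symm z)).compContinuousLinearMap _ = _
    rw [hη _ hz]
    rfl
  have h1 : extDerivM η x w = extDeriv α (ψ x) w := by
    change extDeriv α (ψ x) (fun i => mfderiv (𝓡 N) 𝓘(ℝ, V N) (extChartAt (𝓡 N) x) x (w i)) = _
    exact congrArg _ (funext fun i => mfderiv_extChartAt_self x (w i))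
  rw [h1, extDeriv_apply hα]
  refine Finset.sum_congr rfl fun i _ => congrArg _ ?_
  have hev : (fun z => α z (i.removeNth w)) =ᶠ[𝓝 (ψ x)]
      (fun y => η y fun j => coordField x (i.removeNth w j) y) ∘ ψ.symm := by
    filter_upwards [htarget] with z hz
    exact congrArg (η (ψ.symm z)) (funext fun j => hcoord z hz _)
  have hd : DifferentiableAt ℝ (fun z => α z (i.removeNth w)) (ψ x) :=
    hα.continuousAlternatingMap_apply fun j => differentiableAt_const _
  have hmd : MDifferentiableAt (𝓡 N) 𝓘(ℝ, ℝ)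
      (fun y => η y fun j => coordField x (i.removeNth w j) y) x :=
    mdifferentiableAt_iff_chart.mpr (hd.congr_of_eventuallyEq hev.symm)
  rw [hev.fderiv_eq]
  exact (mvfderiv_eq_fderiv_chart hmd (w i)).symm

end CoordinateField

/-! ### ∇Φ and dΦ in terms of the connection form -/

section CovariantDerivativeOfForms

open Bundle Filter Topology VectorField

variable {N : ℕ} {M : Type*} [TopologicalSpace M] [ChartedSpace (V N) M]
  [IsManifold (𝓡 N) ∞ M]

/-- The covariant derivative of a form that is constant in a smooth frame. -/
lemma covDerivForm_eq_neg_infAct {τ : ∀ y : M, Frame N y} {U : Set M}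
    (hτ : SmoothFrameOn τ U) (hU : IsOpen U) {x : M} (hx : x ∈ U) {k : ℕ}
    (φ : V N [⋀^Fin k]→L[ℝ] ℝ) (η : ∀ x : M, TangentSpace (𝓡 N) x [⋀^Fin k]→L[ℝ] ℝ)
    (hη : ∀ y ∈ U, η y = push (τ y) φ) (nabla : Connection N M)
    (θ : V N →L[ℝ] V N →L[ℝ] V N)
    (hθ : ∀ Y : ∀ y : M, TangentSpace (𝓡 N) y, FieldDiffAt Y x → ∀ a : V N, nabla Y x (τ x a) =
      τ x (mvfderiv (𝓡 N) (fun y => (τ y).symm (Y y)) x (τ x a) + θ a ((τ x).symm (Y x))))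
    (a : V N) (Y : Fin k → ∀ y : M, TangentSpace (𝓡 N) y) (hY : ∀ j, FieldDiffAt (Y j) x) :
    covDerivForm nabla η x (τ x a) Y = -infAct φ (θ a) fun j => (τ x).symm (Y j x) := by
  have hf (j : Fin k) := hτ.mdifferentiableAt_coord hU hx (hY j)
  let f : Fin k → M → V N := fun j y => (τ y).symm (Y j y)
  let D : Fin k → V N := fun j => mvfderiv (𝓡 N) (f j) x (τ x a)
  have happ (y : M) (hy : y ∈ U) (u : Fin k → TangentSpace (𝓡 N) y) :
      η y u = φ fun j => (τ y).symm (u j) := by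
    rw [hη y hy]
    rfl
  have hmv : mvfderiv (𝓡 N) (fun y => η y fun j => Y j y) x (τ x a) =
      ∑ j, φ (Function.update (fun j => f j x) j (D j)) := by
    have h1 : (fun y => η y fun j => Y j y) =ᶠ[𝓝 x] fun y => φ fun j => f j y := by
      filter_upwards [hU.mem_nhds hx] with y hy
      exact happ y hy _
    rw [mvfderiv_congr h1]
    let ψ := extChartAt (𝓡 N) x
    have hψ : ψ.symm (ψ x) = x := extChartAt_to_inv x
    have h2 (j : Fin k) : HasFDerivAt (f j ∘ ψ.symm) (fderiv ℝ (f j ∘ ψ.symm) (ψ x)) (ψ x) :=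
      (mdifferentiableAt_iff_chart.mp (hf j)).hasFDerivAt
    have h3 := (φ.hasFDerivAt fun j => (f j ∘ ψ.symm) (ψ x)).comp (ψ x) (hasFDerivAt_pi.mpr h2)
    have h4 : MDifferentiableAt (𝓡 N) 𝓘(ℝ, ℝ) (fun y => φ fun j => f j y) x :=
      mdifferentiableAt_iff_chart.mpr h3.differentiableAt
    refine (mvfderiv_eq_fderiv_chart h4 (τ x a)).trans ?_
    refine (congrArg (fun A => A (τ x a)) h3.fderiv).trans ?_
    refine (ContinuousMultilinearMap.linearDeriv_apply _ _ _).trans ?_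
    refine Finset.sum_congr rfl fun j _ => ?_
    change φ _ = φ _
    congr 2
    · funext j
      simp only [Function.comp_apply, hψ]
    · exact (mvfderiv_eq_fderiv_chart (hf j) (τ x a)).symm
  -- The coordinate derivatives `D j` also occur in `hmv`, so they cancel and only the `θ` terms
  -- survive.
  have hnab (j : Fin k) : η x (Function.update (fun j => Y j x) j (nabla (Y j) x (τ x a))) =
      φ (Function.update (fun j => f j x) j (D j)) +
        φ (Function.update (fun j => f j x) j (θ a (f j x))) := by
    rw [happ x hx, hθ _ (hY j)]
    rw [← φ.map_update_add]
    congr 1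
    funext b
    by_cases h : b = j
    · subst h
      simp only [Function.update_self, ContinuousLinearEquiv.symm_apply_apply]
      rfl
    · simp only [Function.update_of_ne h]
      rfl
  rw [covDerivForm, hmv, Finset.sum_congr rfl fun j _ => hnab j, Finset.sum_add_distrib,
    infAct_apply]
  ring

/-- For a torsion-free connection, the exterior derivative of a form that is constant in a smooth
frame is the alternation of the action of the connection form. -/
lemma extDerivM_eq_neg_alternatize {τ : ∀ y : M, Frame N y} {U : Set M}
    (hτ : SmoothFrameOn τ U) (hU : IsOpen U) {x : M} (hx : x ∈ U) {k : ℕ}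
    (φ : V N [⋀^Fin k]→L[ℝ] ℝ) (η : ∀ x : M, TangentSpace (𝓡 N) x [⋀^Fin k]→L[ℝ] ℝ)
    (hη : ∀ y ∈ U, η y = push (τ y) φ) (nabla : Connection N M) (htor : nabla.torsion = 0)
    (θ : V N →L[ℝ] V N →L[ℝ] V N)
    (hθ : ∀ Y : ∀ y : M, TangentSpace (𝓡 N) y, FieldDiffAt Y x → ∀ a : V N, nabla Y x (τ x a) =
      τ x (mvfderiv (𝓡 N) (fun y => (τ y).symm (Y y)) x (τ x a) + θ a ((τ x).symm (Y x))))
    (a : Fin (k + 1) → V N) :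
    extDerivM η x (fun i => τ x (a i)) =
      -AlternatingMap.alternatizeUncurryFin (infActMap θ φ) a := by
  -- Vanishing torsion and commuting coordinate fields: the Christoffel symbols are symmetric.
  have hsymm (b c : V N) : nabla (coordField x (τ x c)) x (τ x b) =
      nabla (coordField x (τ x b)) x (τ x c) := by
    have h := nabla.torsion_eq_zero_iff.mp htor (fieldDiffAt_coordField x (τ x b))
      (fieldDiffAt_coordField x (τ x c))
    have h := sub_eq_zero.mp (h.trans (mlieBracket_coordField x (τ x b) (τ x c)))
    have e1 : coordField x (τ x b) x = τ x b := coordField_self x _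
    have e2 : coordField x (τ x c) x = τ x c := coordField_self x _
    rw [e1, e2] at h
    exact h
  -- Linearity in `c`, the differentiated field, is obtained by using `hsymm` to move `c` into the
  -- direction slot.
  let Γ : V N →ₗ[ℝ] V N →ₗ[ℝ] V N := LinearMap.mk₂ ℝ
    (fun b c => (τ x).symm (nabla (coordField x (τ x c)) x (τ x b)))
    (fun b b' c => by simp only [map_add])
    (fun r b c => by simp only [map_smul])
    (fun b c c' => by rw [hsymm b (c + c'), hsymm b c, hsymm b c', map_add, map_add, map_add])
    (fun r b c => by rw [hsymm b (r • c), hsymm b c, map_smul, map_smul, map_smul])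
  let Γc := Γ.toContinuousBilinearMap
  have hΓ : AlternatingMap.alternatizeUncurryFin (infActMap Γc φ) = 0 :=
    alternatize_infActMap_of_symm Γc φ fun b c => congrArg (τ x).symm (hsymm b c)
  -- Equates two expressions for `∇η` on coordinate fields: the definition, where `Γ` enters, and
  -- the frame formula, where `θ` does. Alternation then kills the `Γ` part.
  have hterm (i : Fin (k + 1)) :
      mvfderiv (𝓡 N) (fun y => η y fun j => coordField x (τ x (i.removeNth a j)) y) x (τ x (a i)) =
        infActMap Γc φ (a i) (i.removeNth a) - infActMap θ φ (a i) (i.removeNth a) := by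
    have h2 := covDerivForm_eq_neg_infAct hτ hU hx φ η hη nabla θ hθ (a i)
      (fun j => coordField x (τ x (i.removeNth a j))) (fun j => fieldDiffAt_coordField x _)
    have h3 : (fun j => (τ x).symm (coordField x (τ x (i.removeNth a j)) x)) = i.removeNth a := by
      funext j
      exact (congrArg (τ x).symm (coordField_self x _)).trans ((τ x).symm_apply_apply _)
    rw [h3, covDerivForm] at h2
    have h4 : (∑ j, η x (Function.update (fun j => coordField x (τ x (i.removeNth a j)) x) j
        (nabla (coordField x (τ x (i.removeNth a j))) x (τ x (a i))))) =
        infAct φ (Γc (a i)) (i.removeNth a) := by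
      rw [infAct_apply]
      refine Finset.sum_congr rfl fun j _ => ?_
      rw [hη x hx]
      change φ _ = φ _
      congr 1
      funext b
      by_cases h : b = j
      · subst h
        simp only [Function.update_self]
        rfl
      · simp only [Function.update_of_ne h]
        exact congrFun h3 b
    rw [h4] at h2
    refine (sub_eq_iff_eq_add.mp h2).trans ?_
    rw [neg_add_eq_sub]
    rfl
  have hΓa : AlternatingMap.alternatizeUncurryFin (infActMap Γc φ) a = 0 := by rw [hΓ]; rfl
  rw [← zero_sub, ← hΓa, AlternatingMap.alternatizeUncurryFin_apply,
    AlternatingMap.alternatizeUncurryFin_apply, ← Finset.sum_sub_distrib]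
  refine (extDerivM_apply_coordField hτ hU hx φ η hη fun i => (τ x (a i) : V N)).trans ?_
  refine Finset.sum_congr rfl fun i _ => ?_
  rw [← smul_sub]
  exact congrArg _ (hterm i)

end CovariantDerivativeOfForms

/-! ### Existence of the Levi-Civita connection -/

section LeviCivita

open Bundle Filter Topology VectorField

variable {N : ℕ}

/-- Every antisymmetric `T` is the alternation of a bilinear map with skew values. -/
lemma exists_skew_of_antisymm (T : V N →L[ℝ] V N →L[ℝ] V N) (hT : ∀ a b, T a b = -T b a) :
    ∃ θ : V N →L[ℝ] V N →L[ℝ] V N, (∀ a b, θ a b - θ b a = T a b) ∧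
      ∀ a b c, inner ℝ (θ a b) c + inner ℝ b (θ a c) = 0 := by
  let adj : V N →ₗ[ℝ] V N →ₗ[ℝ] V N := LinearMap.mk₂ ℝ
    (fun a b => ContinuousLinearMap.adjoint (T a) b)
    (fun a a' b => by simp only [map_add, add_apply])
    (fun c a b => by simp)
    (fun a b b' => map_add _ _ _)
    (fun c a b => map_smul _ _ _)
  let A := adj.toContinuousBilinearMap
  have hA (a b c : V N) : inner ℝ (A a b) c = inner ℝ b (T a c) :=
    ContinuousLinearMap.adjoint_inner_left (T a) c b
  have hA' (a b c : V N) : inner ℝ c (A a b) = inner ℝ (T a c) b :=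
    ContinuousLinearMap.adjoint_inner_right (T a) c b
  -- The Koszul formula in an orthonormal frame: `2⟨θ_a b, c⟩ = ⟨T(a,b), c⟩ - ⟨T(b,c), a⟩ - ⟨T(a,c),
  -- b⟩`.
  refine ⟨(1 / 2 : ℝ) • (T - A.flip - A), fun a b => ?_, fun a b c => ?_⟩
  · simp only [smul_apply, sub_apply, ContinuousLinearMap.flip_apply]
    rw [hT b a]
    module
  · simp only [smul_apply, sub_apply, ContinuousLinearMap.flip_apply, inner_smul_left,
      inner_smul_right, inner_sub_left, inner_sub_right, hA, hA']
    rw [hT c b, inner_neg_left, real_inner_comm a (T b c)]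
    simp
    ring

variable {M : Type*} [TopologicalSpace M] [ChartedSpace (V N) M]

/-- The coordinates of a frame field are constant. -/
lemma mvfderiv_coord_frame (τ : ∀ y : M, Frame N y) (x : M) (w : V N) :
    mvfderiv (𝓡 N) (fun y => (τ y).symm (τ y w)) x = 0 := by
  have h : (fun y => (τ y).symm (τ y w)) = fun _ => w :=
    funext fun y => (τ y).symm_apply_apply w
  rw [h]
  exact mvfderiv_const w

/-- The Leibniz rule for the inner product of two vector functions. -/
lemma mvfderiv_inner {f h : M → V N} {x : M} (hf : MDifferentiableAt (𝓡 N) 𝓘(ℝ, V N) f x)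
    (hh : MDifferentiableAt (𝓡 N) 𝓘(ℝ, V N) h x) (v : TangentSpace (𝓡 N) x) :
    mvfderiv (𝓡 N) (fun y => inner ℝ (f y) (h y)) x v =
      inner ℝ (mvfderiv (𝓡 N) f x v) (h x) + inner ℝ (f x) (mvfderiv (𝓡 N) h x v) := by
  have hf' := mdifferentiableAt_iff_chart.mp hf
  have hh' := mdifferentiableAt_iff_chart.mp hh
  have hi : MDifferentiableAt (𝓡 N) 𝓘(ℝ, ℝ) (fun y => inner ℝ (f y) (h y)) x :=
    mdifferentiableAt_iff_chart.mpr (hf'.inner ℝ hh')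
  have h1 := fderiv_inner_apply ℝ hf' hh' v
  refine (mvfderiv_eq_fderiv_chart hi v).trans (h1.trans ?_)
  simp only [Function.comp_apply, extChartAt_to_inv]
  rw [add_comm]
  exact congrArg₂ _ (congrArg (inner ℝ · (h x)) (mvfderiv_eq_fderiv_chart hf v).symm)
    (congrArg (inner ℝ (f x)) (mvfderiv_eq_fderiv_chart hh v).symm)

variable [IsManifold (𝓡 N) ∞ M]

/-- The structure functions of the frame at `x`; only constant combinations of frame fields occur,
so the bracket is bilinear in `a` and `b`. -/
lemma SmoothFrameOn.exists_bracket {τ : ∀ y : M, Frame N y} {U : Set M}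
    (hτ : SmoothFrameOn τ U) (hU : IsOpen U) {x : M} (hx : x ∈ U) :
    ∃ T : V N →L[ℝ] V N →L[ℝ] V N, (∀ a b, T a b = -T b a) ∧ ∀ a b,
      mlieBracket (𝓡 N) (fun y => τ y a) (fun y => τ y b) x = τ x (T a b) := by
  have hd (a : V N) := hτ.fieldDiffAt hU hx a
  have hadd (a b : V N) : (fun y => τ y (a + b)) = (fun y => τ y a) + fun y => τ y b :=
    funext fun y => map_add (τ y) a b
  have hsmul (c : ℝ) (a : V N) : (fun y => τ y (c • a)) = c • fun y => τ y a :=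
    funext fun y => map_smul (τ y) c a
  let T : V N →ₗ[ℝ] V N →ₗ[ℝ] V N := LinearMap.mk₂ ℝ
    (fun a b => (τ x).symm (mlieBracket (𝓡 N) (fun y => τ y a) (fun y => τ y b) x))
    (fun a a' b => by rw [hadd, mlieBracket_add_left (hd a) (hd a'), map_add])
    (fun c a b => by rw [hsmul, mlieBracket_const_smul_left (hd a), map_smul])
    (fun a b b' => by rw [hadd, mlieBracket_add_right (hd b) (hd b'), map_add])
    (fun c a b => by rw [hsmul, mlieBracket_const_smul_right (hd b), map_smul])
  refine ⟨T.toContinuousBilinearMap, fun a b => ?_, fun a b => ?_⟩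
  · change (τ x).symm _ = -(τ x).symm _
    rw [mlieBracket_swap_apply, map_neg]
  · exact ((τ x).apply_symm_apply _).symm

/-- The Levi-Civita connection at one point, in an orthonormal frame. -/
lemma SmoothFrameOn.exists_leviCivita_at {τ : ∀ y : M, Frame N y} {U : Set M}
    (hτ : SmoothFrameOn τ U) (hU : IsOpen U) {x : M} (hx : x ∈ U)
    (g : ∀ x : M, TangentSpace (𝓡 N) x → TangentSpace (𝓡 N) x → ℝ)
    (hg : ∀ y ∈ U, ∀ v w : V N, g y (τ y v) (τ y w) = inner ℝ v w) :
    ∃ D : (∀ y : M, TangentSpace (𝓡 N) y) → TangentSpace (𝓡 N) x →L[ℝ] TangentSpace (𝓡 N) x,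
      (∀ Y Z, FieldDiffAt Y x → FieldDiffAt Z x → D (Y + Z) = D Y + D Z) ∧
      (∀ (Y : ∀ y : M, TangentSpace (𝓡 N) y) (f : M → ℝ), FieldDiffAt Y x →
        MDifferentiableAt (𝓡 N) 𝓘(ℝ, ℝ) f x →
        D (f • Y) = f x • D Y + (mvfderiv (𝓡 N) f x).smulRight (Y x)) ∧
      (∀ v w, ∃ Y Z, FieldDiffAt Y x ∧ FieldDiffAt Z x ∧ Y x = v ∧ Z x = w ∧
        D Z v - D Y w = mlieBracket (𝓡 N) Y Z x) ∧
      (∀ Y Z, FieldDiffAt Y x → FieldDiffAt Z x → ∀ v,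
        mvfderiv (𝓡 N) (fun y => g y (Y y) (Z y)) x v = g x (D Y v) (Z x) + g x (Y x) (D Z v)) := by
  obtain ⟨T, hT, hTτ⟩ := hτ.exists_bracket hU hx
  obtain ⟨θ, hθT, hθ⟩ := exists_skew_of_antisymm T hT
  let f : (∀ y : M, TangentSpace (𝓡 N) y) → M → V N := fun Y y => (τ y).symm (Y y)
  have hf {Y : ∀ y : M, TangentSpace (𝓡 N) y} (hY : FieldDiffAt Y x) :
      MDifferentiableAt (𝓡 N) 𝓘(ℝ, V N) (f Y) x := hτ.mdifferentiableAt_coord hU hx hY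
  let D : (∀ y : M, TangentSpace (𝓡 N) y) → TangentSpace (𝓡 N) x →L[ℝ] TangentSpace (𝓡 N) x :=
    fun Y => (τ x : V N →L[ℝ] TangentSpace (𝓡 N) x) ∘L (mvfderiv (𝓡 N) (f Y) x +
      (θ.flip (f Y x)) ∘L ((τ x).symm : TangentSpace (𝓡 N) x →L[ℝ] V N))
  have hD (Y : ∀ y : M, TangentSpace (𝓡 N) y) (v : TangentSpace (𝓡 N) x) :
      D Y v = τ x (mvfderiv (𝓡 N) (f Y) x v + θ ((τ x).symm v) (f Y x)) := rfl
  refine ⟨D, fun Y Z hY hZ => ?_, fun Y h hY hh => ?_, fun v w => ?_, fun Y Z hY hZ v => ?_⟩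
  · have hfa : f (Y + Z) = f Y + f Z := funext fun y => map_add (τ y).symm (Y y) (Z y)
    have hdf : mvfderiv (𝓡 N) (f Y + f Z) x = mvfderiv (𝓡 N) (f Y) x + mvfderiv (𝓡 N) (f Z) x :=
      mvfderiv_add (hf hY) (hf hZ)
    ext1 v
    rw [add_apply, hD, hD, hD, hfa, hdf, Pi.add_apply, add_apply]
    simp only [map_add]
    abel
  · have hfs : f (h • Y) = h • f Y := funext fun y => map_smul (τ y).symm (h y) (Y y)
    have hdf (v : TangentSpace (𝓡 N) x) : mvfderiv (𝓡 N) (h • f Y) x v =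
        h x • mvfderiv (𝓡 N) (f Y) x v + mvfderiv (𝓡 N) h x v • f Y x := by
      rw [mvfderiv_smul hh (hf hY)]
      rfl
    have hYx : Y x = τ x (f Y x) := ((τ x).apply_symm_apply _).symm
    ext1 v
    rw [add_apply, smul_apply, ContinuousLinearMap.smulRight_apply, hD, hD, hfs, hdf, hYx,
      Pi.smul_apply']
    simp only [map_add, map_smul, smul_add]
    abel
  -- Torsion is tensorial, so one pair of extensions suffices. Frame fields have constant
  -- coordinates, leaving `θ(a)b - θ(b)a = T(a,b)`.
  · refine ⟨fun y => τ y ((τ x).symm v), fun y => τ y ((τ x).symm w), hτ.fieldDiffAt hU hx _,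
      hτ.fieldDiffAt hU hx _, (τ x).apply_symm_apply v, (τ x).apply_symm_apply w, ?_⟩
    have hfx (b : V N) : f (fun y => τ y b) x = b := (τ x).symm_apply_apply b
    have hdf (b : V N) : mvfderiv (𝓡 N) (f fun y => τ y b) x = 0 := mvfderiv_coord_frame τ x b
    rw [hTτ, hD, hD, hfx, hfx, hdf, hdf, ← hθT, ← map_sub]
    simp
  · have h1 : (fun y => g y (Y y) (Z y)) =ᶠ[𝓝 x] fun y => inner ℝ (f Y y) (f Z y) := by
      filter_upwards [hU.mem_nhds hx] with y hy
      rw [← hg y hy]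
      change _ = g y (τ y ((τ y).symm (Y y))) (τ y ((τ y).symm (Z y)))
      rw [(τ y).apply_symm_apply, (τ y).apply_symm_apply]
    have hYx (Y : ∀ y : M, TangentSpace (𝓡 N) y) : Y x = τ x (f Y x) :=
      ((τ x).apply_symm_apply _).symm
    have h2 := hθ ((τ x).symm v) (f Y x) (f Z x)
    rw [mvfderiv_congr h1, mvfderiv_inner (hf hY) (hf hZ), hD, hD, hYx Y, hYx Z, hg x hx, hg x hx,
      inner_add_left, inner_add_right]
    linarith

/-- Additivity, the Leibniz rule, torsion-freeness and metricity are all conditions at a single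
point. Hence each point may use its own local frame, with no gluing. -/
lemma GStructure.exists_isLeviCivita {G : Subgroup (V N ≃L[ℝ] V N)} (hG : G ≤ orthogonal N)
    (Q : GStructure M G) : ∃ nabla : Connection N M, IsLeviCivita Q.metric nabla := by
  choose U hU hx τ hτ hQ using Q.smooth
  have h (x : M) := (hτ x).exists_leviCivita_at (hU x) (hx x) Q.metric fun y hy =>
    Q.metric_eq hG y (τ x y) (hQ x y hy)
  choose D hadd hleib htor hmet using h
  let nabla : Connection N M :=
    { toFun := fun Y x => D x Y
      isCovariantDerivativeOnUniv :=
        { add := fun hY hZ _ => hadd _ _ _ hY hZ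
          leibniz := fun hY hf _ => hleib _ _ _ hY hf } }
  refine ⟨nabla, ?_, fun x Y Z hY hZ v => hmet x Y Z hY hZ v⟩
  funext x
  ext v w
  obtain ⟨Y, Z, hY, hZ, rfl, rfl, h⟩ := htor x v w
  rw [nabla.torsion_apply hY hZ]
  exact sub_eq_zero.mpr h

end LeviCivita

/-! ### The implications between the three conditions -/

section TorsionFree

open Bundle Filter Topology

variable {N l : ℕ} {p : Fin l → ℕ} {ΦV : ∀ i, V N [⋀^Fin (p i)]→L[ℝ] ℝ}
  {M : Type*} [TopologicalSpace M] [ChartedSpace (V N) M] [IsManifold (𝓡 N) ∞ M]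

lemma connection_frame_apply {τ : ∀ y : M, Frame N y} {U : Set M} (hτ : SmoothFrameOn τ U)
    (hU : IsOpen U) {x : M} (hx : x ∈ U) {nabla : Connection N M}
    {θ : V N →L[ℝ] V N →L[ℝ] V N}
    (hθ : ∀ Y : ∀ y : M, TangentSpace (𝓡 N) y, FieldDiffAt Y x → ∀ a : V N, nabla Y x (τ x a) =
      τ x (mvfderiv (𝓡 N) (fun y => (τ y).symm (Y y)) x (τ x a) + θ a ((τ x).symm (Y x))))
    (a w : V N) : nabla (fun y => τ y w) x (τ x a) = τ x (θ a w) := by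
  rw [hθ _ (hτ.fieldDiffAt hU hx w), mvfderiv_coord_frame, (τ x).symm_apply_apply]
  simp

/-- The connection form of a metric connection in an orthonormal frame is skew. -/
lemma IsLeviCivita.connectionForm_skew {G : Subgroup (V N ≃L[ℝ] V N)} (hG : G ≤ orthogonal N)
    {Q : GStructure M G} {τ : ∀ y : M, Frame N y} {U : Set M} (hτ : SmoothFrameOn τ U)
    (hU : IsOpen U) (hQ : ∀ y ∈ U, τ y ∈ Q.frames y) {x : M} (hx : x ∈ U)
    {nabla : Connection N M} (hLC : IsLeviCivita Q.metric nabla) {θ : V N →L[ℝ] V N →L[ℝ] V N}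
    (hθ : ∀ Y : ∀ y : M, TangentSpace (𝓡 N) y, FieldDiffAt Y x → ∀ a : V N, nabla Y x (τ x a) =
      τ x (mvfderiv (𝓡 N) (fun y => (τ y).symm (Y y)) x (τ x a) + θ a ((τ x).symm (Y x))))
    (a v w : V N) : inner ℝ (θ a v) w + inner ℝ v (θ a w) = 0 := by
  have h := hLC.2 x _ _ (hτ.fieldDiffAt hU hx v) (hτ.fieldDiffAt hU hx w) (τ x a)
  have hc : (fun y => Q.metric y (τ y v) (τ y w)) =ᶠ[𝓝 x] fun _ => inner ℝ v w := by
    filter_upwards [hU.mem_nhds hx] with y hy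
    exact Q.metric_eq hG y (τ y) (hQ y hy) v w
  rw [mvfderiv_congr hc, mvfderiv_const, connection_frame_apply hτ hU hx hθ,
    connection_frame_apply hτ hU hx hθ, Q.metric_eq hG x (τ x) (hQ x hx),
    Q.metric_eq hG x (τ x) (hQ x hx)] at h
  exact h.symm

/-- Metricity makes `θ` skew, and with torsion-freeness `dΦ = 0` says that its alternated action on
`Φ^V` vanishes; the algebraic result then places `θ` in `𝔤`. -/
lemma isConnection_of_extDerivM_eq_zero (hG : stabilizer ΦV ≤ orthogonal N)
    (hdim : Module.finrank ℝ (E ΦV 2) = Module.finrank ℝ (PSucc (stabilizer ΦV) 1))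
    (Φ : OrbitSection (M := M) ΦV) {nabla : Connection N M}
    (hLC : IsLeviCivita Φ.toGStructure.metric nabla) (hd : ∀ i, extDerivM (Φ.form i) = 0) :
    Φ.toGStructure.IsConnection nabla := by
  intro U τ hU hτ hQ x hx v
  obtain ⟨θ, hθ⟩ := hτ.exists_connectionForm hU hx nabla
  refine ⟨θ ((τ x).symm v), ?_, fun w => ?_⟩
  · refine mem_lieAlg_of_alternatize_eq_zero ΦV hG hdim θ
      (hLC.connectionForm_skew hG hτ hU hQ hx hθ) (fun i => ?_) _
    ext a
    have h := extDerivM_eq_neg_alternatize hτ hU hx (ΦV i) (Φ.form i) (fun y hy => hQ y hy i)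
      nabla hLC.1 θ hθ a
    rw [hd i] at h
    exact neg_eq_zero.mp h.symm
  · have h := connection_frame_apply hτ hU hx hθ ((τ x).symm v) w
    rwa [(τ x).apply_symm_apply] at h

/-- At each point a single local section of the `G`-bundle suffices: its connection form lies in
`𝔤`, which annihilates `Φ^V`. -/
lemma isParallel_of_isConnection (Φ : OrbitSection (M := M) ΦV) {nabla : Connection N M}
    (hc : Φ.toGStructure.IsConnection nabla) (i : Fin l) : IsParallel nabla (Φ.form i) := by
  intro x v Y hY
  obtain ⟨U, hU, hx, τ, hτ, hQ⟩ := Φ.smooth x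
  obtain ⟨θ, hθ⟩ := hτ.exists_connectionForm hU hx nabla
  obtain ⟨X, hX, hXτ⟩ := hc U τ hU hτ hQ x hx v
  obtain ⟨a, rfl⟩ := (τ x).surjective v
  have hXθ : θ a = X := by
    ext1 w
    exact (τ x).injective ((connection_frame_apply hτ hU hx hθ a w).symm.trans (hXτ w))
  rw [covDerivForm_eq_neg_infAct hτ hU hx (ΦV i) (Φ.form i) (fun y hy => hQ y hy i) nabla θ hθ a Y
    hY, hXθ, (mem_lieAlg_stabilizer_iff ΦV X).mp hX i]
  exact neg_zero

/-- Testing `∇Φ = 0` on frame fields shows that `θ` annihilates `Φ^V`, so the alternated action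
giving `dΦ` is zero. -/
lemma extDerivM_eq_zero_of_isParallel (Φ : OrbitSection (M := M) ΦV) {nabla : Connection N M}
    (htor : nabla.torsion = 0) {i : Fin l} (hp : IsParallel nabla (Φ.form i)) :
    extDerivM (Φ.form i) = 0 := by
  funext x
  obtain ⟨U, hU, hx, τ, hτ, hQ⟩ := Φ.smooth x
  obtain ⟨θ, hθ⟩ := hτ.exists_connectionForm hU hx nabla
  have hη : ∀ y ∈ U, Φ.form i y = push (τ y) (ΦV i) := fun y hy => hQ y hy i
  have hinf (a : V N) : infAct (ΦV i) (θ a) = 0 := by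
    ext w
    have h := covDerivForm_eq_neg_infAct hτ hU hx (ΦV i) (Φ.form i) hη nabla θ hθ a
      (fun j y => τ y (w j)) (fun j => hτ.fieldDiffAt hU hx (w j))
    rw [hp x _ _ fun j => hτ.fieldDiffAt hU hx (w j)] at h
    simp only [ContinuousLinearEquiv.symm_apply_apply] at h
    exact neg_eq_zero.mp h.symm
  have hmap : infActMap θ (ΦV i) = 0 := by
    ext a w
    exact congrArg (fun φ => φ w) (hinf a)
  ext v
  have h := extDerivM_eq_neg_alternatize hτ hU hx (ΦV i) (Φ.form i) hη nabla htor θ hθ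
    fun j => (τ x).symm (v j)
  simp only [ContinuousLinearEquiv.apply_symm_apply] at h
  rw [h, hmap, AlternatingMap.alternatizeUncurryFin_apply]
  simp

end TorsionFree

end OrbitForm

end

theorem theorem2p6 {N l : ℕ} {p : Fin l → ℕ}
    (ΦV : ∀ i, OrbitForm.V N [⋀^Fin (p i)]→L[ℝ] ℝ)
    (hG : OrbitForm.stabilizer ΦV ≤ OrbitForm.orthogonal N)
    (hdim : Module.finrank ℝ (OrbitForm.E ΦV 2) =
      Module.finrank ℝ (OrbitForm.PSucc (OrbitForm.stabilizer ΦV) 1))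
    {M : Type*} [TopologicalSpace M] [ChartedSpace (OrbitForm.V N) M] [IsManifold (𝓡 N) ∞ M]
    (Φ : OrbitForm.OrbitSection (M := M) ΦV) :
    (∃ nabla : OrbitForm.Connection N M,
      OrbitForm.IsLeviCivita Φ.toGStructure.metric nabla) ∧
    ∀ nabla : OrbitForm.Connection N M,
      OrbitForm.IsLeviCivita Φ.toGStructure.metric nabla →
      List.TFAE [
        ∀ i, OrbitForm.extDerivM (Φ.form i) = 0,
        Φ.toGStructure.IsTorsionFree,
        ∀ i, OrbitForm.IsParallel nabla (Φ.form i)] := by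
  refine ⟨Φ.toGStructure.exists_isLeviCivita hG, fun nabla hLC => ?_⟩
  tfae_have 1 → 2 := fun hd =>
    ⟨nabla, hLC, OrbitForm.isConnection_of_extDerivM_eq_zero hG hdim Φ hLC hd⟩
  -- The connection comes from condition (ii) itself and need not be identified with `nabla`, so
  -- uniqueness of the Levi-Civita connection plays no role.
  tfae_have 2 → 1 := fun ⟨_, hLC', hc⟩ i =>
    OrbitForm.extDerivM_eq_zero_of_isParallel Φ hLC'.1
      (OrbitForm.isParallel_of_isConnection Φ hc i)
  tfae_have 1 → 3 := fun hd =>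
    OrbitForm.isParallel_of_isConnection Φ
      (OrbitForm.isConnection_of_extDerivM_eq_zero hG hdim Φ hLC hd)
  tfae_have 3 → 1 := fun hp i => OrbitForm.extDerivM_eq_zero_of_isParallel Φ hLC.1 (hp i)
  tfae_finish
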